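/- Let $R$ be a compact connected Riemann surface and $F$ a holomorphic line bundle on $R$, with an open covering $\{U_j\}$ of $R$ and local frames $m_j$ of $F$ on $U_j$ such that $m_k = a_{jk} m_j$ on $U_{jk}=U_j\cap U_k$. (In Grauert's example $R$ has genus at least $2$ and $\deg F = 1$; this is not needed here.) Let $\{\xi_{jk} m_j\}$ be a Čech $1$-cocycle of $\{U_j\}$ with values in $\mathcal O_R(F)$, with class $[\xi]\in \check H^1(\{U_j\},\mathcal O_R(F))$. Let $X$ be the compact complex surface glued from the $U_j\times(\mathbb C\cup\{\infty\})$ by $\eta_j = a_{jk}\eta_k+\xi_{jk}$, $p\colon X\to R$ the projection, $Y\subset X$ the section at infinity $\{\eta_j=\infty\}$, $\theta_j = 1/\eta_j$ on $V_j = \{\eta_j\neq 0\}\subset p^{-1}(U_j)$, $W_j = V_j\cap Y$, and $L = p^*F\otimes[Y]$. Let $v_j$ be the frame of $[Y]$ on $V_j$ such that $v_j\theta_j$ is the canonical section, and let $e_j = p^*m_j\otimes v_j$. The first obstruction class $u_1(Y,X,L)\in H^1(Y,\mathcal O_Y(N_{Y/X}^{-1}))$ is defined as follows. Choose open sets $V'_i$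 of $X$ covering $Y$, holomorphic defining functions $\theta'_i$ of $Y$ on $V'_i$, and frames $e'_i$ of $L$ on $V'_i$ with $t_{ik}^{-1}e'_k = e'_i$ on $Y\cap V'_i\cap V'_k$ for constants $t_{ik}\in U(1)$. Expand $t_{ik}^{-1}e'_k/e'_i = 1+f_{ik}\theta'_i+O(|\theta'_i|^2)$ along $Y$ with $f_{ik}$ holomorphic. Then $u_1(Y,X,L)$ is the class of the cochain $\{f_{ik}\,d\theta'_i|_Y\}$. Then: 1. For every choice of such data the cochain $\{f_{ik}\,d\theta'_i|_Y\}$ is a cocycle, and its class in $H^1(Y,\mathcal O_Y(N_{Y/X}^{-1}))$ is the same class $u_1(Y,X,L)$. 2. For all $j,k$, $\;e_k/e_j = 1-\xi_{jk}\theta_j+o(\theta_j)$ near every point of $W_j\cap W_k$. The data $V_j,\theta_j,e_j$ with all $t_{jk}=1$ are admissible with $f_{jk}=-\xi_{jk}\circ p$, so $u_1(Y,X,L)$ is represented by the cocycle $\{-\xi_{jk}\,d\theta_j\}$ on $\{W_j\}$. 3. There is an isomorphism of holomorphic line bundles $N_{Y/X}^{-1}\cong (p|_Y)^*F$ taking $d\theta_j$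 to $p^*m_j$. The cocycle $\{-\xi_{jk}\,d\theta_j\}$ is a coboundary on $\{W_j\}$ if and only if $[\xi]=0$. 4. If $[\xi]\neq 0$, then $u_1(Y,X,L)\neq 0$. If $[\xi]=0$, then $u_1(Y,X,L)=0$. In particular $u_1(Y,X,L)\ne 0$ for Grauert's surface, where $[\xi]\neq0$ by assumption. -/

import Mathlib

open Set Filter Topology TopologicalSpace
open scoped Manifold ContDiff Asymptotics

universe u v w

/-! ### Sheaves of sections and Čech cohomology in degree one -/

/-- A sheaf of abelian groups on `T` whose sections over an open set `U` are families of elements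
of the groups `M t`, `t ∈ U`, subject to a local condition.  A section is written as a family over
all of `T`; whether it is a section over `U` depends on its values at the points of `U` only. -/
structure SectionSheaf (T : Type u) [TopologicalSpace T] (M : T → Type v)
    [∀ t, AddCommGroup (M t)] where
  sec : Opens T → AddSubgroup (∀ t, M t)
  congr' : ∀ (U : Opens T) (s s' : ∀ t, M t), (∀ t ∈ U, s t = s' t) → s ∈ sec U → s' ∈ sec U
  restrict' : ∀ (U V : Opens T) (s : ∀ t, M t), V ≤ U → s ∈ sec U → s ∈ sec V
  local' : ∀ (U : Opens T) (s : ∀ t, M t),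
    (∀ t ∈ U, ∃ V : Opens T, t ∈ V ∧ V ≤ U ∧ s ∈ sec V) → s ∈ sec U

namespace SectionSheaf

variable {T : Type u} [TopologicalSpace T] {M : T → Type v} [∀ t, AddCommGroup (M t)]
  (𝓕 : SectionSheaf T M)

/-- Čech `1`-cocycles of a family of open sets with values in `𝓕`: families of sections
`c j k` over `W j ∩ W k` with `c j k + c k l = c j l` on `W j ∩ W k ∩ W l`. -/
def Z1 {ι : Type w} (W : ι → Opens T) : AddSubgroup (ι → ι → ∀ t, M t) where
  carrier := {c | (∀ j k, c j k ∈ 𝓕.sec (W j ⊓ W k)) ∧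
    ∀ j k l t, t ∈ W j → t ∈ W k → t ∈ W l → c j k t + c k l t = c j l t}
  add_mem' := by
    rintro c d ⟨hc, hc'⟩ ⟨hd, hd'⟩
    refine ⟨fun j k => add_mem (hc j k) (hd j k), fun j k l t h1 h2 h3 => ?_⟩
    simp only [Pi.add_apply]
    rw [← hc' j k l t h1 h2 h3, ← hd' j k l t h1 h2 h3]
    abel
  zero_mem' := ⟨fun j k => zero_mem _, fun j k l t _ _ _ => by simp⟩
  neg_mem' := by
    rintro c ⟨hc, hc'⟩
    refine ⟨fun j k => neg_mem (hc j k), fun j k l t h1 h2 h3 => ?_⟩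
    simp only [Pi.neg_apply]
    rw [← hc' j k l t h1 h2 h3]
    abel

/-- Čech `1`-coboundaries: the cocycles of the form `b k - b j` on `W j ∩ W k`, for sections
`b j` over `W j`. -/
def B1 {ι : Type w} (W : ι → Opens T) : AddSubgroup (𝓕.Z1 W) where
  carrier := {c | ∃ b : ι → ∀ t, M t, (∀ j, b j ∈ 𝓕.sec (W j)) ∧
    ∀ j k t, t ∈ W j → t ∈ W k → c.1 j k t = b k t - b j t}
  add_mem' := by
    rintro c d ⟨b, hb, hb'⟩ ⟨b', hd, hd'⟩
    refine ⟨b + b', fun j => add_mem (hb j) (hd j), fun j k t h1 h2 => ?_⟩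
    have e1 := hb' j k t h1 h2
    have e2 := hd' j k t h1 h2
    simp only [AddSubgroup.coe_add, Pi.add_apply] at *
    rw [e1, e2]
    abel
  zero_mem' := ⟨0, fun j => zero_mem _, fun j k t _ _ => by simp⟩
  neg_mem' := by
    rintro c ⟨b, hb, hb'⟩
    refine ⟨-b, fun j => neg_mem (hb j), fun j k t h1 h2 => ?_⟩
    have e1 := hb' j k t h1 h2
    simp only [AddSubgroup.coe_neg, Pi.neg_apply] at *
    rw [e1]
    abel

/-- The Čech cohomology group `Ȟ¹(W, 𝓕)` of a family of open sets. -/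
def CechH1 {ι : Type w} (W : ι → Opens T) : Type _ := 𝓕.Z1 W ⧸ 𝓕.B1 W

instance {ι : Type w} (W : ι → Opens T) : AddCommGroup (𝓕.CechH1 W) :=
  inferInstanceAs (AddCommGroup (𝓕.Z1 W ⧸ 𝓕.B1 W))

/-- The class of a cocycle in `Ȟ¹(W, 𝓕)`. -/
def cechClass {ι : Type w} (W : ι → Opens T) : 𝓕.Z1 W →+ 𝓕.CechH1 W :=
  QuotientAddGroup.mk' (𝓕.B1 W)

variable {ι : Type w} {κ : Type*}

/-- Restriction of cocycles to a refinement `W'` of `W` along a refinement map `ρ`. -/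
def refineZ1 (W : ι → Opens T) (W' : κ → Opens T) (ρ : κ → ι) (h : ∀ a, W' a ≤ W (ρ a)) :
    𝓕.Z1 W →+ 𝓕.Z1 W' where
  toFun c := ⟨fun a b => c.1 (ρ a) (ρ b),
    fun a b => 𝓕.restrict' _ _ _ (inf_le_inf (h a) (h b)) (c.2.1 _ _),
    fun a b d t h1 h2 h3 => c.2.2 _ _ _ t (h a h1) (h b h2) (h d h3)⟩
  map_zero' := rfl
  map_add' _ _ := rfl

/-- The map `Ȟ¹(W, 𝓕) → Ȟ¹(W', 𝓕)` induced by a refinement. -/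
def refineH1 (W : ι → Opens T) (W' : κ → Opens T) (ρ : κ → ι) (h : ∀ a, W' a ≤ W (ρ a)) :
    𝓕.CechH1 W →+ 𝓕.CechH1 W' :=
  QuotientAddGroup.map _ _ (𝓕.refineZ1 W W' ρ h) (by
    rintro c ⟨b, hb, hb'⟩
    exact ⟨fun a => b (ρ a), fun a => 𝓕.restrict' _ _ _ (h a) (hb _),
      fun a a' t h1 h2 => hb' _ _ t (h a h1) (h a' h2)⟩)

end SectionSheaf

/-- Open coverings `W` of `T` indexed by the points of `T`, with `t ∈ W t`.  They are cofinal among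
all open coverings. -/
abbrev PointCover (T : Type u) [TopologicalSpace T] : Type u :=
  {W : T → Opens T // ∀ t, t ∈ W t}

namespace SectionSheaf

variable {T : Type u} [TopologicalSpace T] {M : T → Type v} [∀ t, AddCommGroup (M t)]
  (𝓕 : SectionSheaf T M)

/-- The transition maps between the Čech groups of point-indexed coverings. -/
noncomputable def transition (W W' : (PointCover T)ᵒᵈ) (h : W ≤ W') :
    𝓕.CechH1 (OrderDual.ofDual W).1 →+ 𝓕.CechH1 (OrderDual.ofDual W').1 :=
  𝓕.refineH1 _ _ id (fun t => (show (OrderDual.ofDual W').1 ≤ (OrderDual.ofDual W).1 from h) t)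

open scoped Classical in
/-- The cohomology group `H¹(T, 𝓕)`: the direct limit of the Čech groups over the open coverings of
`T`, ordered by refinement. -/
def H1 : Type _ :=
  AddCommGroup.DirectLimit (ι := (PointCover T)ᵒᵈ)
    (fun W => 𝓕.CechH1 (OrderDual.ofDual W).1) 𝓕.transition

open scoped Classical in
noncomputable instance : AddCommGroup 𝓕.H1 :=
  AddCommGroup.DirectLimit.addCommGroup (ι := (PointCover T)ᵒᵈ)
    (fun W => 𝓕.CechH1 (OrderDual.ofDual W).1) 𝓕.transition

open scoped Classical in
/-- The canonical map of the Čech group of a point-indexed covering to `H¹(T, 𝓕)`. -/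
noncomputable def ofPointCover (W : PointCover T) : 𝓕.CechH1 W.1 →+ 𝓕.H1 :=
  AddCommGroup.DirectLimit.of (ι := (PointCover T)ᵒᵈ)
    (fun W => 𝓕.CechH1 (OrderDual.ofDual W).1) 𝓕.transition (OrderDual.toDual W)

/-- The canonical map `Ȟ¹(W, 𝓕) → H¹(T, 𝓕)` of an open covering `W`, through the restriction
to a point-indexed refinement. -/
noncomputable def toH1 {ι : Type w} (W : ι → Opens T) (hW : ∀ t, ∃ j, t ∈ W j) :
    𝓕.CechH1 W →+ 𝓕.H1 :=
  (𝓕.ofPointCover ⟨fun t => W (hW t).choose, fun t => (hW t).choose_spec⟩).comp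
    (𝓕.refineH1 W (fun t => W (hW t).choose) (fun t => (hW t).choose) (fun _ => le_rfl))

end SectionSheaf

/-! ### Holomorphic line bundles -/

/-- A holomorphic function on an open set of a complex manifold modelled on `E`. -/
def IsHol (E : Type*) [NormedAddCommGroup E] [NormedSpace ℂ E] {X : Type*} [TopologicalSpace X]
    [ChartedSpace E X] (U : Opens X) (f : X → ℂ) : Prop :=
  ContMDiffOn 𝓘(ℂ, E) 𝓘(ℂ, ℂ) ω f (U : Set X)

/-- A holomorphic line bundle on a complex manifold `X` modelled on `E`, given by an open covering
and a system of holomorphic transition functions.  A section is a family of functions `s i` on the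
sets `dom i` with `s i = g i j * s j` on overlaps. -/
structure HolLineBundle (E : Type*) [NormedAddCommGroup E] [NormedSpace ℂ E] (X : Type u)
    [TopologicalSpace X] [ChartedSpace E X] where
  ι : Type u
  dom : ι → Opens X
  cover : ∀ x, ∃ i, x ∈ dom i
  g : ι → ι → X → ℂ
  hol : ∀ i j, IsHol E (dom i ⊓ dom j) (g i j)
  ne_zero : ∀ i j x, x ∈ dom i → x ∈ dom j → g i j x ≠ 0
  cocycle : ∀ i j k x, x ∈ dom i → x ∈ dom j → x ∈ dom k → g i j x * g j k x = g i k x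

section IsHol

variable {E : Type*} [NormedAddCommGroup E] [NormedSpace ℂ E] {X : Type*} [TopologicalSpace X]
  [ChartedSpace E X] {U V : Opens X} {f g : X → ℂ}

theorem IsHol.mono (h : IsHol E U f) (hV : V ≤ U) : IsHol E V f := ContMDiffOn.mono h hV

theorem IsHol.add (hf : IsHol E U f) (hg : IsHol E U g) : IsHol E U (fun x => f x + g x) :=
  ContMDiffOn.add hf hg

theorem IsHol.mul (hf : IsHol E U f) (hg : IsHol E U g) : IsHol E U (fun x => f x * g x) :=
  ContMDiffOn.mul hf hg

theorem IsHol.neg (hf : IsHol E U f) : IsHol E U (fun x => - f x) :=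
  ContMDiffOn.neg hf

theorem IsHol.const (c : ℂ) : IsHol E U (fun _ => c) := contMDiffOn_const

theorem IsHol.congr (hf : IsHol E U f) (h : ∀ x ∈ U, g x = f x) : IsHol E U g :=
  ContMDiffOn.congr hf h

theorem IsHol.of_local (h : ∀ x ∈ U, ∃ V : Opens X, x ∈ V ∧ IsHol E V f) : IsHol E U f := by
  intro x hx
  obtain ⟨V, hxV, hV⟩ := h x hx
  exact ((hV x hxV).contMDiffAt (V.isOpen.mem_nhds hxV)).contMDiffWithinAt

theorem IsHol.inv (hf : IsHol E U f) (h : ∀ x ∈ U, f x ≠ 0) : IsHol E U (fun x => (f x)⁻¹) := by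
  intro x hx
  exact ((contDiffAt_inv ℂ (h x hx)).contMDiffAt).comp_contMDiffWithinAt x (hf x hx)

theorem IsHol.mdifferentiableAt (hf : IsHol E U f) {x : X} (hx : x ∈ U) :
    MDifferentiableAt 𝓘(ℂ, E) 𝓘(ℂ, ℂ) f x :=
  ((hf x hx).contMDiffAt (U.isOpen.mem_nhds hx)).mdifferentiableAt (by simp)

theorem IsHol.comp {E' : Type*} [NormedAddCommGroup E'] [NormedSpace ℂ E'] {X' : Type*}
    [TopologicalSpace X'] [ChartedSpace E' X'] (hf : IsHol E U f) {p : X' → X}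
    (hp : ContMDiff 𝓘(ℂ, E') 𝓘(ℂ, E) ω p) {U' : Opens X'} (h : ∀ x ∈ U', p x ∈ U) :
    IsHol E' U' (fun x => f (p x)) :=
  ContMDiffOn.comp hf hp.contMDiffOn h

end IsHol

namespace HolLineBundle

variable {E : Type*} [NormedAddCommGroup E] [NormedSpace ℂ E] {X : Type u}
  [TopologicalSpace X] [ChartedSpace E X] (L : HolLineBundle E X)

/-- The fibre of `L` at `x`: the values `v i` at `x` of a section in the various local
trivializations around `x`, related by the transition functions. -/
def fiber (x : X) : Submodule ℂ (L.ι → ℂ) where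
  carrier := {v | (∀ i, x ∉ L.dom i → v i = 0) ∧
    ∀ i j, x ∈ L.dom i → x ∈ L.dom j → v i = L.g i j x * v j}
  add_mem' := by
    rintro v w ⟨h1, h2⟩ ⟨h3, h4⟩
    refine ⟨fun i hi => by simp [h1 i hi, h3 i hi], fun i j hi hj => ?_⟩
    simp only [Pi.add_apply]
    rw [h2 i j hi hj, h4 i j hi hj, mul_add]
  zero_mem' := ⟨fun i _ => rfl, fun i j _ _ => by simp⟩
  smul_mem' := by
    rintro c v ⟨h1, h2⟩
    refine ⟨fun i hi => by simp [h1 i hi], fun i j hi hj => ?_⟩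
    simp only [Pi.smul_apply, smul_eq_mul]
    rw [h2 i j hi hj]
    ring

/-- `s` is a holomorphic section of `L` over the open set `U`. -/
def IsHolSection (U : Opens X) (s : ∀ x, L.fiber x) : Prop :=
  ∀ i, IsHol E (U ⊓ L.dom i) (fun x => (s x).1 i)

/-- `e` is a local frame of `L` over the open set `U`: a nowhere vanishing holomorphic section. -/
def IsFrame (U : Opens X) (e : ∀ x, L.fiber x) : Prop :=
  L.IsHolSection U e ∧ ∀ x ∈ U, e x ≠ 0

/-- The sheaf `𝒪(L)` of holomorphic sections of `L`. -/
def sheaf : SectionSheaf X (fun x => L.fiber x) where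
  sec U :=
    { carrier := {s | L.IsHolSection U s}
      add_mem' := fun hs ht i => (hs i).add (ht i)
      zero_mem' := fun _ => IsHol.const 0
      neg_mem' := fun hs i => (hs i).neg }
  congr' U s s' h hs i := (hs i).congr (fun x hx => by rw [h x hx.1])
  restrict' U V s hVU hs i := (hs i).mono (inf_le_inf_right _ hVU)
  local' U s h i := IsHol.of_local fun x hx => by
    obtain ⟨V, hxV, hVU, hV⟩ := h x hx.1
    exact ⟨V ⊓ L.dom i, ⟨hxV, hx.2⟩, hV i⟩

/-- The sheaf `𝒪_Y(L|_Y)` on a subset `Y` of `X`: sections over `Y` which locally extend to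
holomorphic sections of `L` on open sets of `X`. -/
def restrictSheaf (Y : Set X) : SectionSheaf Y (fun y => L.fiber y.1) where
  sec W :=
    { carrier := {s | ∀ y ∈ W, ∃ O : Opens X, y.1 ∈ O ∧ ∃ σ : ∀ x, L.fiber x,
        L.IsHolSection O σ ∧ ∀ z ∈ W, z.1 ∈ O → s z = σ z.1}
      add_mem' := by
        intro s t hs ht y hy
        obtain ⟨O, hO, σ, h1, h2⟩ := hs y hy
        obtain ⟨O', hO', σ', h1', h2'⟩ := ht y hy
        exact ⟨O ⊓ O', ⟨hO, hO'⟩, σ + σ',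
          fun i => ((h1 i).mono (inf_le_inf_right _ inf_le_left)).add
            ((h1' i).mono (inf_le_inf_right _ inf_le_right)),
          fun z hz hzO => by simp [h2 z hz hzO.1, h2' z hz hzO.2]⟩
      zero_mem' := fun y _ => ⟨⊤, trivial, 0, fun _ => IsHol.const 0, fun z _ _ => rfl⟩
      neg_mem' := by
        intro s hs y hy
        obtain ⟨O, hO, σ, h1, h2⟩ := hs y hy
        exact ⟨O, hO, -σ, fun i => (h1 i).neg, fun z hz hzO => by simp [h2 z hz hzO]⟩ }
  congr' W s s' h hs y hy := by
    obtain ⟨O, hO, σ, h1, h2⟩ := hs y hy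
    exact ⟨O, hO, σ, h1, fun z hz hzO => by rw [← h z hz, h2 z hz hzO]⟩
  restrict' U V s hVU hs y hy := by
    obtain ⟨O, hO, σ, h1, h2⟩ := hs y (hVU hy)
    exact ⟨O, hO, σ, h1, fun z hz hzO => h2 z (hVU hz) hzO⟩
  local' U s h y hy := by
    obtain ⟨V, hyV, hVU, hV⟩ := h y hy
    obtain ⟨O, hO, σ, h1, h2⟩ := hV y hyV
    obtain ⟨O', hO', hVO'⟩ := isOpen_induced_iff.1 V.isOpen
    refine ⟨O ⊓ ⟨O', hO'⟩, ⟨hO, ?_⟩, σ, fun i => (h1 i).mono (inf_le_inf_right _ inf_le_left),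
      fun z hz hzO => h2 z ?_ hzO.1⟩
    · have : y ∈ (V : Set Y) := hyV
      rw [← hVO'] at this
      exact this
    · have : z ∈ Subtype.val ⁻¹' O' := hzO.2
      rw [hVO'] at this
      exact this

open scoped Classical in
/-- The frame `m_i` of `L` over `dom i` given by the `i`-th trivialization: its component in the
trivialization `i'` is `g i' i`.  (Extended by zero outside `dom i`.)  Thus `m_k = g j k • m_j`. -/
noncomputable def frame (i : L.ι) (x : X) : L.fiber x :=
  ⟨fun i' => if x ∈ L.dom i ∧ x ∈ L.dom i' then L.g i' i x else 0, by
    refine ⟨fun i' hi' => if_neg fun h => hi' h.2, fun i₁ i₂ h₁ h₂ => ?_⟩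
    by_cases hx : x ∈ L.dom i
    · simp [hx, h₁, h₂, L.cocycle _ _ _ x h₁ h₂ hx]
    · simp [hx]⟩

/-- The quotient `u / v` of two elements of the fibre of `L` at `x`, computed in any local
trivialization around `x`. -/
noncomputable def quot {x : X} (u v : L.fiber x) : ℂ :=
  u.1 (L.cover x).choose / v.1 (L.cover x).choose

/-- The pullback `p^*L`. -/
def pullback {E' : Type*} [NormedAddCommGroup E'] [NormedSpace ℂ E'] {X' : Type u}
    [TopologicalSpace X'] [ChartedSpace E' X'] (p : X' → X)
    (hp : ContMDiff 𝓘(ℂ, E') 𝓘(ℂ, E) ω p) : HolLineBundle E' X' where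
  ι := L.ι
  dom i := ⟨p ⁻¹' L.dom i, (L.dom i).isOpen.preimage hp.continuous⟩
  cover x := L.cover (p x)
  g i j x := L.g i j (p x)
  hol i j := (L.hol i j).comp hp fun _ hx => hx
  ne_zero i j x := L.ne_zero i j (p x)
  cocycle i j k x := L.cocycle i j k (p x)

/-- The tensor product `L ⊗ M`. -/
def tensor (M : HolLineBundle E X) : HolLineBundle E X where
  ι := L.ι × M.ι
  dom i := L.dom i.1 ⊓ M.dom i.2
  cover x := by
    obtain ⟨i, hi⟩ := L.cover x
    obtain ⟨j, hj⟩ := M.cover x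
    exact ⟨(i, j), hi, hj⟩
  g i j x := L.g i.1 j.1 x * M.g i.2 j.2 x
  hol i j := ((L.hol i.1 j.1).mono (inf_le_inf inf_le_left inf_le_left)).mul
    ((M.hol i.2 j.2).mono (inf_le_inf inf_le_right inf_le_right))
  ne_zero i j x hi hj := mul_ne_zero (L.ne_zero _ _ x hi.1 hj.1) (M.ne_zero _ _ x hi.2 hj.2)
  cocycle i j k x hi hj hk := by
    rw [← L.cocycle _ _ _ x hi.1 hj.1 hk.1, ← M.cocycle _ _ _ x hi.2 hj.2 hk.2]
    ring

/-- The element `u ⊗ v` of the fibre of `L ⊗ M`. -/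
def tmul {L M : HolLineBundle E X} {x : X} (u : L.fiber x) (v : M.fiber x) :
    (L.tensor M).fiber x :=
  ⟨fun i => u.1 i.1 * v.1 i.2, by
    constructor
    · rintro ⟨i, k⟩ hi
      change u.1 i * v.1 k = 0
      by_cases h : x ∈ L.dom i
      · rw [v.2.1 k fun h' => hi ⟨h, h'⟩, mul_zero]
      · rw [u.2.1 i h, zero_mul]
    · rintro ⟨i, k⟩ ⟨j, l⟩ hi hj
      change u.1 i * v.1 k = (L.g i j x * M.g k l x) * (u.1 j * v.1 l)
      rw [u.2.2 i j hi.1 hj.1, v.2.2 k l hi.2 hj.2]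
      ring⟩

end HolLineBundle

/-! ### Conormal sheaf and first obstruction class of a hypersurface -/

section Obstruction

variable {E : Type*} [NormedAddCommGroup E] [NormedSpace ℂ E] {X : Type u}
  [TopologicalSpace X] [ChartedSpace E X]

variable (E) in
/-- The fibre at `x` of the conormal bundle of a submanifold `Y`: the covectors `dφ(x)`, for
holomorphic functions `φ` near `x` that vanish on `Y`. -/
def conormalSpace (Y : Set X) (x : X) : Submodule ℂ (TangentSpace 𝓘(ℂ, E) x →L[ℂ] ℂ) where
  carrier := {α | ∃ O : Opens X, x ∈ O ∧ ∃ φ : X → ℂ, IsHol E O φ ∧ (∀ z ∈ O, z ∈ Y → φ z = 0) ∧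
    α = mvfderiv 𝓘(ℂ, E) φ x}
  add_mem' := by
    rintro _ _ ⟨O, hO, φ, h1, h2, rfl⟩ ⟨O', hO', φ', h1', h2', rfl⟩
    refine ⟨O ⊓ O', ⟨hO, hO'⟩, φ + φ', (h1.mono inf_le_left).add (h1'.mono inf_le_right),
      fun z hz hY => by simp [h2 z hz.1 hY, h2' z hz.2 hY], ?_⟩
    rw [mvfderiv_add (h1.mdifferentiableAt hO) (h1'.mdifferentiableAt hO')]
  zero_mem' := ⟨⊤, trivial, fun _ => 0, IsHol.const 0, fun _ _ _ => rfl, by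
    rw [mvfderiv_const]⟩
  smul_mem' := by
    rintro c _ ⟨O, hO, φ, h1, h2, rfl⟩
    refine ⟨O, hO, fun z => c * φ z, (IsHol.const c).mul h1,
      fun z hz hY => by simp [h2 z hz hY], ?_⟩
    have h : mvfderiv 𝓘(ℂ, E) (fun z => c * φ z) x = _ :=
      mvfderiv_mul (f := fun _ => c) mdifferentiableAt_const (h1.mdifferentiableAt hO)
    rw [h, mvfderiv_const]
    simp

variable (E) in
/-- The sheaf `𝒪_Y(N_{Y/X}⁻¹)` of holomorphic sections of the conormal bundle of `Y` in `X`: the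
sections that are locally of the form `dφ|_Y` for a holomorphic function `φ` on an open set of `X`
that vanishes on `Y` (the sheaf `I_Y / I_Y²`). -/
def conormalSheaf (Y : Set X) : SectionSheaf Y (fun y => conormalSpace E Y y.1) where
  sec W :=
    { carrier := {s | ∀ y ∈ W, ∃ O : Opens X, y.1 ∈ O ∧ ∃ φ : X → ℂ, IsHol E O φ ∧
        (∀ z ∈ O, z ∈ Y → φ z = 0) ∧
        ∀ z ∈ W, z.1 ∈ O → (s z).1 = mvfderiv 𝓘(ℂ, E) φ z.1}
      add_mem' := by
        intro s t hs ht y hy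
        obtain ⟨O, hO, φ, h0, h1, h2⟩ := hs y hy
        obtain ⟨O', hO', φ', h0', h1', h2'⟩ := ht y hy
        refine ⟨O ⊓ O', ⟨hO, hO'⟩, φ + φ', (h0.mono inf_le_left).add (h0'.mono inf_le_right),
          fun z hz hY => by simp [h1 z hz.1 hY, h1' z hz.2 hY], fun z hz hzO => ?_⟩
        rw [mvfderiv_add (h0.mdifferentiableAt hzO.1) (h0'.mdifferentiableAt hzO.2),
          ← h2 z hz hzO.1, ← h2' z hz hzO.2]
        rfl
      zero_mem' := fun y _ => ⟨⊤, trivial, fun _ => 0, IsHol.const 0, fun _ _ _ => rfl,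
        fun z _ _ => by rw [mvfderiv_const]; rfl⟩
      neg_mem' := by
        intro s hs y hy
        obtain ⟨O, hO, φ, h0, h1, h2⟩ := hs y hy
        refine ⟨O, hO, -φ, h0.neg, fun z hz hY => by simp [h1 z hz hY], fun z hz hzO => ?_⟩
        rw [mvfderiv_neg, ← h2 z hz hzO]
        rfl }
  congr' W s s' h hs y hy := by
    obtain ⟨O, hO, φ, h0, h1, h2⟩ := hs y hy
    exact ⟨O, hO, φ, h0, h1, fun z hz hzO => by rw [← h z hz, h2 z hz hzO]⟩
  restrict' U V s hVU hs y hy := by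
    obtain ⟨O, hO, φ, h0, h1, h2⟩ := hs y (hVU hy)
    exact ⟨O, hO, φ, h0, h1, fun z hz hzO => h2 z (hVU hz) hzO⟩
  local' U s h y hy := by
    obtain ⟨V, hyV, hVU, hV⟩ := h y hy
    obtain ⟨O, hO, φ, h0, h1, h2⟩ := hV y hyV
    obtain ⟨O', hO', hVO'⟩ := isOpen_induced_iff.1 V.isOpen
    refine ⟨O ⊓ ⟨O', hO'⟩, ⟨hO, ?_⟩, φ, h0.mono inf_le_left, fun z hz => h1 z hz.1,
      fun z hz hzO => h2 z ?_ hzO.1⟩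
    · have : y ∈ (V : Set Y) := hyV
      rw [← hVO'] at this
      exact this
    · have : z ∈ Subtype.val ⁻¹' O' := hzO.2
      rw [hVO'] at this
      exact this

variable (E) in
/-- `θ` is a holomorphic defining function on the open set `V` of the smooth hypersurface `Y`. -/
def IsDefiningFunction (Y : Set X) (V : Opens X) (θ : X → ℂ) : Prop :=
  IsHol E V θ ∧ (∀ x ∈ V, x ∈ Y ↔ θ x = 0) ∧ ∀ x ∈ V, x ∈ Y → mvfderiv 𝓘(ℂ, E) θ x ≠ 0

/-- The local data from which the first obstruction class of `(Y, X, L)` is computed, for a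
hypersurface `Y` of `X` and a line bundle `L` on `X`: an open covering `V j` of a neighbourhood
of `Y`, defining functions `θ j` of `Y` on `V j`, frames `e j` of `L` over `V j` with
`(t j k)⁻¹ e k = e j` on `Y ∩ V j ∩ V k` for constants `t j k ∈ U(1)`, and the coefficients `f j k`
of the expansion `(t j k)⁻¹ e k / e j = 1 + f j k * θ j + O(θ j ^ 2)` along `Y`.  The coefficient is
given as a holomorphic function on `V j ∩ V k`; only its restriction to `Y` matters (and is
determined by the expansion). -/
structure ObstructionSystem (ι : Type u) (Y : Set X) (L : HolLineBundle E X) where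
  V : ι → Opens X
  cover : ∀ y : Y, ∃ j, y.1 ∈ V j
  θ : ι → X → ℂ
  defining : ∀ j, IsDefiningFunction E Y (V j) (θ j)
  e : ι → ∀ x, L.fiber x
  frame : ∀ j, L.IsFrame (V j) (e j)
  t : ι → ι → Circle
  flat : ∀ j k, ∀ y ∈ Y, y ∈ V j → y ∈ V k → ((t j k : ℂ)⁻¹) • e k y = e j y
  f : ι → ι → X → ℂ
  hol : ∀ j k, IsHol E (V j ⊓ V k) (f j k)
  expansion : ∀ j k, ∀ y ∈ Y, y ∈ V j → y ∈ V k →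
    (fun x => L.quot ((t j k : ℂ)⁻¹ • e k x) (e j x) - (1 + f j k x * θ j x))
      =O[𝓝 y] (fun x => θ j x ^ 2)

namespace ObstructionSystem

variable {ι : Type u} {Y : Set X} {L : HolLineBundle E X} (S : ObstructionSystem ι Y L)

/-- The open covering `W j = V j ∩ Y` of `Y`. -/
def W (j : ι) : Opens Y := ⟨Subtype.val ⁻¹' (S.V j), (S.V j).isOpen.preimage continuous_subtype_val⟩

open scoped Classical in
/-- The `1`-cochain `f j k dθ j` on `W j ∩ W k`, extended by zero. -/
noncomputable def cochain (j k : ι) (y : Y) : conormalSpace E Y y.1 :=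
  if h : y.1 ∈ S.V j ∧ y.1 ∈ S.V k then
    S.f j k y.1 • ⟨mvfderiv 𝓘(ℂ, E) (S.θ j) y.1,
      ⟨S.V j, h.1, S.θ j, (S.defining j).1, fun z hz hY => ((S.defining j).2.1 z hz).1 hY, rfl⟩⟩
  else 0

/-- The class in `Ȟ¹({W j}, 𝒪_Y(N_{Y/X}⁻¹))` of the cochain, if it is a cocycle. -/
noncomputable def cechClass (h : S.cochain ∈ (conormalSheaf E Y).Z1 S.W) :
    (conormalSheaf E Y).CechH1 S.W :=
  (conormalSheaf E Y).cechClass S.W ⟨S.cochain, h⟩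

/-- Its image in `H¹(Y, 𝒪_Y(N_{Y/X}⁻¹))`. -/
noncomputable def cohClass (h : S.cochain ∈ (conormalSheaf E Y).Z1 S.W) :
    (conormalSheaf E Y).H1 :=
  (conormalSheaf E Y).toH1 S.W S.cover (S.cechClass h)

end ObstructionSystem

open scoped Classical in
/-- The first obstruction class `u₁(Y, X, L) ∈ H¹(Y, 𝒪_Y(N_{Y/X}⁻¹))`: the class of the cocycle
`f j k dθ j`, for any choice of local data (zero by convention if there is no such data). -/
noncomputable def firstObstructionClass (Y : Set X) (L : HolLineBundle E X) :
    (conormalSheaf E Y).H1 :=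
  if h : ∃ u : (conormalSheaf E Y).H1, ∃ (ι : Type u) (S : ObstructionSystem ι Y L)
    (hS : S.cochain ∈ (conormalSheaf E Y).Z1 S.W), u = S.cohClass hS
  then h.choose else 0

end Obstruction

/-! ### The projective line `ℂ ∪ {∞}` -/

namespace ProjLine

/-- The coordinate `θ = 1 / η` on `ℂ ∪ {∞}`, with `θ(∞) = 0` (to be used away from `η = 0`). -/
noncomputable def theta (v : OnePoint ℂ) : ℂ := v.elim 0 (fun z => z⁻¹)

/-- The inverse of the coordinate `θ`. -/
noncomputable def thetaInv (w : ℂ) : OnePoint ℂ := if w = 0 then OnePoint.infty else ((w⁻¹ : ℂ) : OnePoint ℂ)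

/-- The extension of the affine map `η ↦ a η + b` to `ℂ ∪ {∞}`, fixing `∞`. -/
def affine (a b : ℂ) : OnePoint ℂ → OnePoint ℂ := OnePoint.map (fun z => a * z + b)

@[simp] theorem theta_infty : theta OnePoint.infty = 0 := rfl
@[simp] theorem theta_coe (z : ℂ) : theta (z : OnePoint ℂ) = z⁻¹ := rfl
@[simp] theorem thetaInv_zero : thetaInv 0 = OnePoint.infty := by simp [thetaInv]
@[simp] theorem affine_infty (a b : ℂ) : affine a b OnePoint.infty = OnePoint.infty := rfl
@[simp] theorem affine_coe (a b z : ℂ) : affine a b (z : OnePoint ℂ) = ((a * z + b : ℂ) : OnePoint ℂ) := rfl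

theorem thetaInv_of_ne {w : ℂ} (h : w ≠ 0) : thetaInv w = ((w⁻¹ : ℂ) : OnePoint ℂ) := by
  simp [thetaInv, h]

theorem theta_thetaInv (w : ℂ) : theta (thetaInv w) = w := by
  by_cases h : w = 0
  · simp [h]
  · simp [thetaInv_of_ne h]

theorem thetaInv_ne (w : ℂ) : thetaInv w ≠ ((0 : ℂ) : OnePoint ℂ) := by
  by_cases h : w = 0
  · simp [h]
  · rw [thetaInv_of_ne h]
    simpa using h

theorem thetaInv_theta {v : OnePoint ℂ} (h : v ≠ ((0 : ℂ) : OnePoint ℂ)) :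
    thetaInv (theta v) = v := by
  induction v using OnePoint.rec with
  | infty => simp
  | coe z =>
    have hz : z ≠ 0 := fun h' => h (by rw [h'])
    rw [theta_coe, thetaInv_of_ne (inv_ne_zero hz), inv_inv]

theorem affine_eq_thetaInv {a b : ℂ} {v : OnePoint ℂ} (hv : v ≠ ((0 : ℂ) : OnePoint ℂ))
    (h : a + b * theta v ≠ 0) : affine a b v = thetaInv (theta v / (a + b * theta v)) := by
  induction v using OnePoint.rec with
  | infty => simp
  | coe z =>
    have hz : z ≠ 0 := fun h' => hv (by rw [h'])
    rw [theta_coe] at *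
    rw [thetaInv_of_ne (div_ne_zero (inv_ne_zero hz) h), affine_coe]
    congr 1
    field_simp

/-- `θ` of the image under an affine map, on the set where both sides are finite. -/
theorem theta_affine {a b : ℂ} (ha : a ≠ 0) {v : OnePoint ℂ} (hv : v ≠ ((0 : ℂ) : OnePoint ℂ))
    (hv' : affine a b v ≠ ((0 : ℂ) : OnePoint ℂ)) :
    a + b * theta v ≠ 0 ∧ theta (affine a b v) = theta v / (a + b * theta v) := by
  have h : a + b * theta v ≠ 0 := by
    induction v using OnePoint.rec with
    | infty => simpa using ha
    | coe z =>
      have hz : z ≠ 0 := fun h' => hv (by rw [h'])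
      intro h
      apply hv'
      rw [affine_coe]
      congr 1
      rw [theta_coe] at h
      field_simp at h
      simpa using h
  exact ⟨h, by rw [affine_eq_thetaInv hv h, theta_thetaInv]⟩

theorem continuous_thetaInv : Continuous thetaInv := by
  rw [continuous_iff_continuousAt]
  intro w
  by_cases hw : w = 0
  · subst hw
    rw [continuousAt_iff_punctured_nhds, thetaInv_zero]
    have h1 : Tendsto (fun w : ℂ => ((w⁻¹ : ℂ) : OnePoint ℂ)) (𝓝[≠] 0) (𝓝 OnePoint.infty) := by
      refine OnePoint.tendsto_coe_infty.comp ?_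
      rw [coclosedCompact_eq_cocompact, ← Metric.cobounded_eq_cocompact]
      exact tendsto_inv₀_nhdsNE_zero
    refine h1.congr' ?_
    filter_upwards [self_mem_nhdsWithin] with x hx
    rw [thetaInv_of_ne hx]
  · have h1 : ContinuousAt (fun w : ℂ => ((w⁻¹ : ℂ) : OnePoint ℂ)) w :=
      OnePoint.continuous_coe.continuousAt.comp (continuousAt_inv₀ hw)
    refine h1.congr ?_
    filter_upwards [isOpen_ne.mem_nhds hw] with x hx
    rw [thetaInv_of_ne hx]

theorem continuousOn_theta : ContinuousOn theta {v | v ≠ ((0 : ℂ) : OnePoint ℂ)} := by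
  intro v hv
  apply ContinuousAt.continuousWithinAt
  induction v using OnePoint.rec with
  | infty =>
    rw [OnePoint.continuousAt_infty', coclosedCompact_eq_cocompact,
      ← Metric.cobounded_eq_cocompact]
    exact tendsto_inv₀_cobounded
  | coe z =>
    have hz : z ≠ 0 := fun h' => hv (by rw [h'])
    rw [OnePoint.continuousAt_coe]
    exact continuousAt_inv₀ hz

/-- The two standard charts of the projective line: `η` on `ℂ` (for `false`) and `θ = 1 / η` on the
complement of `0` (for `true`). -/
noncomputable def chart : Bool → OpenPartialHomeomorph (OnePoint ℂ) ℂ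
  | false => (OnePoint.isOpenEmbedding_coe.toOpenPartialHomeomorph ((↑) : ℂ → OnePoint ℂ)).symm
  | true =>
    { toFun := theta
      invFun := thetaInv
      source := {v | v ≠ ((0 : ℂ) : OnePoint ℂ)}
      target := univ
      map_source' := fun _ _ => trivial
      map_target' := fun w _ => thetaInv_ne w
      left_inv' := fun _ h => thetaInv_theta h
      right_inv' := fun w _ => theta_thetaInv w
      open_source := isOpen_ne
      open_target := isOpen_univ
      continuousOn_toFun := continuousOn_theta
      continuousOn_invFun := continuous_thetaInv.continuousOn }

theorem chart_false_source : (chart false).source = {v | v ≠ OnePoint.infty} := by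
  ext v
  simp only [chart, OpenPartialHomeomorph.symm_source,
    Topology.IsOpenEmbedding.toOpenPartialHomeomorph_target, mem_ofPred_eq]
  exact OnePoint.ne_infty_iff_exists.symm

theorem chart_false_symm (z : ℂ) : (chart false).symm z = (z : OnePoint ℂ) := rfl

theorem chart_false_coe (z : ℂ) : chart false (z : OnePoint ℂ) = z :=
  (chart false).right_inv (x := z) (by simp [chart])

theorem continuousOn_affine {B : Type*} [TopologicalSpace B] {U : Set B} {a b : B → ℂ}
    (ha : ContinuousOn a U) (hb : ContinuousOn b U) (h : ∀ x ∈ U, a x ≠ 0) :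
    ContinuousOn (fun q : B × OnePoint ℂ => affine (a q.1) (b q.1) q.2) (U ×ˢ univ) := by
  rintro ⟨x, v⟩ ⟨hx, -⟩
  have ha' : ContinuousWithinAt (fun q : B × OnePoint ℂ => a q.1) (U ×ˢ univ) (x, v) :=
    (ha x hx).comp continuousWithinAt_fst (fun q hq => hq.1)
  have hb' : ContinuousWithinAt (fun q : B × OnePoint ℂ => b q.1) (U ×ˢ univ) (x, v) :=
    (hb x hx).comp continuousWithinAt_fst (fun q hq => hq.1)
  induction v using OnePoint.rec with
  | infty =>
    have hθ : ContinuousWithinAt (fun q : B × OnePoint ℂ => theta q.2) (U ×ˢ univ)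
        (x, OnePoint.infty) :=
      ContinuousAt.comp_continuousWithinAt (g := theta)
        (continuousOn_theta.continuousAt (isOpen_ne.mem_nhds (by simp)))
        continuousWithinAt_snd
    have hden := ha'.add (hb'.mul hθ)
    have hne : a x + b x * theta OnePoint.infty ≠ 0 := by simpa using h x hx
    have hG := (continuous_thetaInv.continuousAt).comp_continuousWithinAt (hθ.div hden hne)
    refine hG.congr_of_eventuallyEq ?_ ?_
    · have h1 := hden.eventually_ne hne
      have h2 : ∀ᶠ q in 𝓝[U ×ˢ univ] (x, (OnePoint.infty : OnePoint ℂ)),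
          q.2 ≠ ((0 : ℂ) : OnePoint ℂ) :=
        continuousWithinAt_snd.eventually_ne (by simp)
      filter_upwards [h1, h2] with q h1 h2
      exact affine_eq_thetaInv h2 h1
    · exact affine_eq_thetaInv (by simp) hne
  | coe z =>
    have hη : ContinuousWithinAt (fun q : B × OnePoint ℂ => chart false q.2) (U ×ˢ univ)
        (x, (z : OnePoint ℂ)) :=
      ContinuousAt.comp_continuousWithinAt (g := chart false)
        ((chart false).continuousAt (by rw [chart_false_source]; simp))
        continuousWithinAt_snd
    have hG := (OnePoint.continuous_coe (X := ℂ)).continuousAt.comp_continuousWithinAt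
      ((ha'.mul hη).add hb')
    have key : ∀ q : B × OnePoint ℂ, q.2 ≠ OnePoint.infty →
        affine (a q.1) (b q.1) q.2 = ((a q.1 * chart false q.2 + b q.1 : ℂ) : OnePoint ℂ) := by
      rintro ⟨y, v⟩ hv
      induction v using OnePoint.rec with
      | infty => exact absurd rfl hv
      | coe w => rw [chart_false_coe, affine_coe]
    refine hG.congr_of_eventuallyEq ?_ ?_
    · have h2 : ∀ᶠ q in 𝓝[U ×ˢ univ] (x, (z : OnePoint ℂ)), q.2 ≠ OnePoint.infty :=
        continuousWithinAt_snd.eventually_ne (by simp)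
      filter_upwards [h2] with q h2
      exact key q h2
    · exact key (x, (z : OnePoint ℂ)) (by simp)

end ProjLine

/-! ### Grauert's surface -/

namespace Grauert

variable {R : Type u} [TopologicalSpace R] [ChartedSpace ℂ R]
  (F : HolLineBundle ℂ R) (ξ : F.sheaf.Z1 F.dom)

/-- The holomorphic function `ξ_{jk}` on `U j ∩ U k` with `ξ j k = ξ_{jk} m_j`, for the frame `m_j`
of `F` over `U j`. -/
def coeff (j k : F.ι) (t : R) : ℂ := (ξ.1 j k t).1 j

theorem g_self (j : F.ι) (t : R) (h : t ∈ F.dom j) : F.g j j t = 1 := by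
  have h1 := F.cocycle j j j t h h h
  have h2 := F.ne_zero j j t h h
  exact mul_left_cancel₀ h2 (by rw [h1, mul_one])

theorem coeff_cocycle (j k l : F.ι) (t : R) (hj : t ∈ F.dom j) (hk : t ∈ F.dom k)
    (hl : t ∈ F.dom l) :
    coeff F ξ j k t + F.g j k t * coeff F ξ k l t = coeff F ξ j l t := by
  have h1 := ξ.2.2 j k l t hj hk hl
  have h2 : (ξ.1 j k t).1 j + (ξ.1 k l t).1 j = (ξ.1 j l t).1 j := by
    rw [← h1]; rfl
  rw [(ξ.1 k l t).2.2 j k hj hk] at h2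
  exact h2

theorem coeff_self (j : F.ι) (t : R) (hj : t ∈ F.dom j) : coeff F ξ j j t = 0 := by
  have h := coeff_cocycle F ξ j j j t hj hj hj
  rw [g_self F j t hj] at h
  linear_combination h

theorem coeff_hol (j k : F.ι) : IsHol ℂ (F.dom j ⊓ F.dom k) (coeff F ξ j k) :=
  (ξ.2.1 j k j).mono (le_inf le_rfl inf_le_left)

/-- The gluing data of the compactified affine bundle: the charts `U j × (ℂ ∪ {∞})` are glued by
`η_j = a_{jk} η_k + ξ_{jk}`.  (`coordChange k j` is the passage from `η_k` to `η_j`.) -/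
noncomputable def core : FiberBundleCore F.ι R (OnePoint ℂ) where
  baseSet j := F.dom j
  isOpen_baseSet j := (F.dom j).isOpen
  indexAt t := (F.cover t).choose
  mem_baseSet_at t := (F.cover t).choose_spec
  coordChange k j t := ProjLine.affine (F.g j k t) (coeff F ξ j k t)
  coordChange_self j t hj v := by
    rw [g_self F j t hj, coeff_self F ξ j t hj]
    induction v using OnePoint.rec <;> simp
  continuousOn_coordChange k j :=
    ProjLine.continuousOn_affine
      (((F.hol j k).continuousOn).mono fun _ h => ⟨h.2, h.1⟩)
      (((coeff_hol F ξ j k).continuousOn).mono fun _ h => ⟨h.2, h.1⟩)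
      (fun x hx => F.ne_zero j k x hx.2 hx.1)
  coordChange_comp i j k t ht v := by
    obtain ⟨⟨hi, hj⟩, hk⟩ := ht
    induction v using OnePoint.rec with
    | infty => simp
    | coe z =>
      simp only [ProjLine.affine_coe]
      rw [← F.cocycle k j i t hk hj hi, ← coeff_cocycle F ξ k j i t hk hj hi]
      congr 1
      ring

/-- The surface `X`: the affine line bundle `A_{F, ξ}` over `R`, compactified by the section at
infinity. -/
def Surface : Type u := (core F ξ).TotalSpace

instance : TopologicalSpace (Surface F ξ) := inferInstanceAs (TopologicalSpace (core F ξ).TotalSpace)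

/-- The projection `p : X → R`. -/
def proj (x : Surface F ξ) : R := Bundle.TotalSpace.proj x

/-- The local trivialization `p⁻¹(U j) ≃ U j × (ℂ ∪ {∞})`. -/
noncomputable def triv (j : F.ι) : OpenPartialHomeomorph (Surface F ξ) (R × OnePoint ℂ) :=
  ((core F ξ).localTriv j).toOpenPartialHomeomorph

/-- The fibre coordinate `η_j` on `p⁻¹(U j)`, with values in `ℂ ∪ {∞}`. -/
noncomputable def eta (j : F.ι) (x : Surface F ξ) : OnePoint ℂ := (triv F ξ j x).2

/-- The fibre coordinate `θ_j = 1 / η_j`. -/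
noncomputable def theta (j : F.ι) (x : Surface F ξ) : ℂ := ProjLine.theta (eta F ξ j x)

variable {F ξ}

theorem triv_apply (j : F.ι) (x : Surface F ξ) : triv F ξ j x = (proj F ξ x, eta F ξ j x) := rfl

theorem triv_source (j : F.ι) : (triv F ξ j).source = proj F ξ ⁻¹' (F.dom j) :=
  ((core F ξ).localTriv j).source_eq

theorem triv_target (j : F.ι) : (triv F ξ j).target = (F.dom j : Set R) ×ˢ univ :=
  ((core F ξ).localTriv j).target_eq

theorem eta_change {j k : F.ι} {x : Surface F ξ} (hj : proj F ξ x ∈ F.dom j)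
    (hk : proj F ξ x ∈ F.dom k) :
    eta F ξ j x = ProjLine.affine (F.g j k (proj F ξ x)) (coeff F ξ j k (proj F ξ x))
      (eta F ξ k x) :=
  ((core F ξ).coordChange_comp ((core F ξ).indexAt (proj F ξ x)) k j (proj F ξ x)
    ⟨⟨(core F ξ).mem_baseSet_at _, hk⟩, hj⟩ x.2).symm

theorem eta_eq_infty_iff {j : F.ι} {x : Surface F ξ} :
    eta F ξ j x = OnePoint.infty ↔ x.2 = (OnePoint.infty : OnePoint ℂ) := by
  change ProjLine.affine _ _ x.2 = _ ↔ _
  generalize (x.2 : OnePoint ℂ) = v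
  induction v using OnePoint.rec
  · exact iff_of_true rfl rfl
  · rw [ProjLine.affine_coe]
    exact iff_of_false (OnePoint.coe_ne_infty _) (OnePoint.coe_ne_infty _)

theorem triv_symm {j : F.ι} {t : R} (ht : t ∈ F.dom j) (v : OnePoint ℂ) :
    proj F ξ ((triv F ξ j).symm (t, v)) = t ∧ eta F ξ j ((triv F ξ j).symm (t, v)) = v := by
  have h := (triv F ξ j).right_inv (x := (t, v)) (by rw [triv_target]; exact ⟨ht, trivial⟩)
  rw [triv_apply] at h
  exact ⟨congrArg Prod.fst h, congrArg Prod.snd h⟩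

variable (F ξ)

/-- The charts of `X`: on `p⁻¹(U j)`, a chart of `R` together with `η_j` or `θ_j`. -/
noncomputable def bigChart (j : F.ι) (c : OpenPartialHomeomorph R ℂ) (b : Bool) :
    OpenPartialHomeomorph (Surface F ξ) (ℂ × ℂ) :=
  (triv F ξ j).trans (c.prod (ProjLine.chart b))

theorem bigChart_source (j : F.ι) (c : OpenPartialHomeomorph R ℂ) (b : Bool) :
    (bigChart F ξ j c b).source = {x | proj F ξ x ∈ F.dom j ∧ proj F ξ x ∈ c.source ∧
      eta F ξ j x ∈ (ProjLine.chart b).source} := by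
  ext x
  simp only [bigChart, OpenPartialHomeomorph.trans_source, triv_source,
    OpenPartialHomeomorph.prod_source, mem_inter_iff, mem_preimage, mem_ofPred_eq]
  rfl

theorem bigChart_apply (j : F.ι) (c : OpenPartialHomeomorph R ℂ) (b : Bool) (x : Surface F ξ) :
    bigChart F ξ j c b x = (c (proj F ξ x), ProjLine.chart b (eta F ξ j x)) := rfl

theorem exists_chart (j : F.ι) (x : Surface F ξ) :
    ∃ b, eta F ξ j x ∈ (ProjLine.chart b).source := by
  by_cases h : eta F ξ j x = OnePoint.infty
  · refine ⟨true, ?_⟩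
    rw [h]
    change OnePoint.infty ≠ _
    simp
  · exact ⟨false, by rw [ProjLine.chart_false_source]; exact h⟩

noncomputable instance : ChartedSpace (ℂ × ℂ) (Surface F ξ) where
  atlas := {e | ∃ j, ∃ c ∈ atlas ℂ R, ∃ b, e = bigChart F ξ j c b}
  chartAt x := bigChart F ξ (F.cover (proj F ξ x)).choose (chartAt ℂ (proj F ξ x))
    (exists_chart F ξ (F.cover (proj F ξ x)).choose x).choose
  mem_chart_source x := by
    rw [bigChart_source]
    exact ⟨(F.cover (proj F ξ x)).choose_spec, mem_chart_source ℂ _,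
      (exists_chart F ξ (F.cover (proj F ξ x)).choose x).choose_spec⟩
  chart_mem_atlas x := ⟨_, _, chart_mem_atlas ℂ _, _, rfl⟩

/-- The coordinate change between two charts of the projective line, read through an affine map. -/
theorem contDiffOn_affine {D : Set (ℂ × ℂ)} {A B : ℂ × ℂ → ℂ} (hA : ContDiffOn ℂ ω A D)
    (hB : ContDiffOn ℂ ω B D) (hA0 : ∀ q ∈ D, A q ≠ 0) (b b' : Bool)
    (hD : ∀ q ∈ D, q.2 ∈ (ProjLine.chart b).target ∧
      ProjLine.affine (A q) (B q) ((ProjLine.chart b).symm q.2) ∈ (ProjLine.chart b').source) :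
    ContDiffOn ℂ ω (fun q => ProjLine.chart b'
      (ProjLine.affine (A q) (B q) ((ProjLine.chart b).symm q.2))) D := by
  have h2 : ContDiffOn ℂ ω (fun q : ℂ × ℂ => q.2) D := contDiff_snd.contDiffOn
  cases b <;> cases b'
  · refine ((hA.mul h2).add hB).congr fun q _ => ?_
    rw [ProjLine.chart_false_symm, ProjLine.affine_coe, ProjLine.chart_false_coe]
  · refine (((hA.mul h2).add hB).inv fun q hq h0 => (hD q hq).2 ?_).congr fun q _ => ?_
    · rw [ProjLine.chart_false_symm, ProjLine.affine_coe, h0]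
    · rw [ProjLine.chart_false_symm, ProjLine.affine_coe]
      rfl
  · have hne : ∀ q ∈ D, q.2 ≠ 0 := by
      intro q hq h0
      have := (hD q hq).2
      rw [ProjLine.chart_false_source, h0] at this
      apply this
      change ProjLine.affine _ _ (ProjLine.thetaInv 0) = _
      simp
    refine ((hA.mul (h2.inv hne)).add hB).congr fun q hq => ?_
    change ProjLine.chart false (ProjLine.affine _ _ (ProjLine.thetaInv q.2)) = _
    rw [ProjLine.thetaInv_of_ne (hne q hq), ProjLine.affine_coe, ProjLine.chart_false_coe]
    rfl
  · have key : ∀ q ∈ D, A q + B q * q.2 ≠ 0 ∧ ProjLine.theta (ProjLine.affine (A q) (B q)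
        (ProjLine.thetaInv q.2)) = q.2 / (A q + B q * q.2) := by
      intro q hq
      have := ProjLine.theta_affine (b := B q) (hA0 q hq) (ProjLine.thetaInv_ne q.2) (hD q hq).2
      rwa [ProjLine.theta_thetaInv] at this
    refine (h2.div (hA.add (hB.mul h2)) fun q hq => (key q hq).1).congr fun q hq => ?_
    exact (key q hq).2

/-- `X` is a complex manifold of dimension two. -/
instance [IsManifold 𝓘(ℂ) ω R] : IsManifold 𝓘(ℂ, ℂ × ℂ) ω (Surface F ξ) := by
  apply isManifold_of_contDiffOn
  rintro _ _ ⟨j, c, hc, b, rfl⟩ ⟨j', c', hc', b', rfl⟩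
  simp only [modelWithCornersSelf_coe, modelWithCornersSelf_coe_symm, Function.comp_def, id,
    range_id, inter_univ]
  set D := ((bigChart F ξ j c b).symm.trans (bigChart F ξ j' c' b')).source with hDdef
  have hD : ∀ q ∈ D, q.1 ∈ c.target ∧ q.2 ∈ (ProjLine.chart b).target ∧ c.symm q.1 ∈ F.dom j ∧
      c.symm q.1 ∈ F.dom j' ∧ c.symm q.1 ∈ c'.source ∧
      proj F ξ ((bigChart F ξ j c b).symm q) = c.symm q.1 ∧
      eta F ξ j' ((bigChart F ξ j c b).symm q) =
        ProjLine.affine (F.g j' j (c.symm q.1)) (coeff F ξ j' j (c.symm q.1))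
          ((ProjLine.chart b).symm q.2) ∧
      ProjLine.affine (F.g j' j (c.symm q.1)) (coeff F ξ j' j (c.symm q.1))
          ((ProjLine.chart b).symm q.2) ∈ (ProjLine.chart b').source := by
    intro q hq
    rw [hDdef, OpenPartialHomeomorph.trans_source] at hq
    obtain ⟨h1, h2⟩ := hq
    have h2' : (bigChart F ξ j c b).symm q ∈ (bigChart F ξ j' c' b').source := h2
    rw [bigChart_source] at h2'
    have h1' : q ∈ (bigChart F ξ j c b).target := h1
    rw [bigChart, OpenPartialHomeomorph.trans_target] at h1'
    have ht : ((c.prod (ProjLine.chart b)).symm q) ∈ (triv F ξ j).target := h1'.2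
    rw [triv_target] at ht
    have hs := triv_symm (ξ := ξ) ht.1 ((ProjLine.chart b).symm q.2)
    have hp : proj F ξ ((bigChart F ξ j c b).symm q) = c.symm q.1 := hs.1
    have he : eta F ξ j ((bigChart F ξ j c b).symm q) = (ProjLine.chart b).symm q.2 := hs.2
    obtain ⟨h3, h4, h5⟩ := h2'
    have hj : c.symm q.1 ∈ F.dom j := ht.1
    have hch := eta_change (ξ := ξ) (x := (bigChart F ξ j c b).symm q) h3 (hp.symm ▸ hj)
    rw [he, hp] at hch
    rw [hp] at h3 h4
    exact ⟨h1'.1.1, h1'.1.2, hj, h3, h4, hp, hch, hch ▸ h5⟩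
  have hpc : ContMDiffOn 𝓘(ℂ, ℂ × ℂ) 𝓘(ℂ) ω (fun q : ℂ × ℂ => c.symm q.1) D :=
    (contMDiffOn_symm_of_mem_maximalAtlas (IsManifold.subset_maximalAtlas hc)).comp
      (contMDiff_iff_contDiff.2 contDiff_fst).contMDiffOn (fun q hq => (hD q hq).1)
  have hA : ContDiffOn ℂ ω (fun q : ℂ × ℂ => F.g j' j (c.symm q.1)) D :=
    contMDiffOn_iff_contDiffOn.1 (ContMDiffOn.comp (F.hol j' j) hpc
      fun q hq => ⟨(hD q hq).2.2.2.1, (hD q hq).2.2.1⟩)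
  have hB : ContDiffOn ℂ ω (fun q : ℂ × ℂ => coeff F ξ j' j (c.symm q.1)) D :=
    contMDiffOn_iff_contDiffOn.1 (ContMDiffOn.comp (coeff_hol F ξ j' j) hpc
      fun q hq => ⟨(hD q hq).2.2.2.1, (hD q hq).2.2.1⟩)
  have h1 : ContDiffOn ℂ ω (fun q : ℂ × ℂ => c' (c.symm q.1)) D :=
    contMDiffOn_iff_contDiffOn.1 (ContMDiffOn.comp
      (contMDiffOn_of_mem_maximalAtlas (IsManifold.subset_maximalAtlas hc')) hpc
      fun q hq => (hD q hq).2.2.2.2.1)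
  have h2 := contDiffOn_affine hA hB
    (fun q hq => F.ne_zero j' j _ (hD q hq).2.2.2.1 (hD q hq).2.2.1) b b'
    (fun q hq => ⟨(hD q hq).2.1, (hD q hq).2.2.2.2.2.2.2⟩)
  refine (h1.prodMk h2).congr fun q hq => ?_
  change bigChart F ξ j' c' b' ((bigChart F ξ j c b).symm q) = _
  rw [bigChart_apply, (hD q hq).2.2.2.2.2.1, (hD q hq).2.2.2.2.2.2.1]

theorem isOpen_V (j : F.ι) :
    IsOpen {x : Surface F ξ | proj F ξ x ∈ F.dom j ∧ eta F ξ j x ≠ ((0 : ℂ) : OnePoint ℂ)} := by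
  have h := (triv F ξ j).isOpen_inter_preimage (s := univ ×ˢ {v | v ≠ ((0 : ℂ) : OnePoint ℂ)})
    (isOpen_univ.prod isOpen_ne)
  rw [triv_source] at h
  convert h using 1
  ext x
  simp [triv_apply]

/-- The curve at infinity `Y ⊂ X`, given by `η_j = ∞`. -/
def Y : Set (Surface F ξ) := {x | ∃ j, proj F ξ x ∈ F.dom j ∧ eta F ξ j x = OnePoint.infty}

/-- The open neighbourhood `V j = {η_j ≠ 0}` of `Y ∩ p⁻¹(U j)` in `p⁻¹(U j)`, on which `θ_j` is
defined. -/
noncomputable def V (j : F.ι) : Opens (Surface F ξ) := ⟨_, isOpen_V F ξ j⟩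

variable {F ξ}

theorem mem_Y_iff {j : F.ι} {x : Surface F ξ} :
    x ∈ Y F ξ ↔ eta F ξ j x = OnePoint.infty := by
  constructor
  · rintro ⟨k, hk, h⟩
    rw [eta_eq_infty_iff] at h ⊢
    exact h
  · intro h
    obtain ⟨k, hk⟩ := F.cover (proj F ξ x)
    refine ⟨k, hk, ?_⟩
    rw [eta_eq_infty_iff] at h ⊢
    exact h

theorem theta_eq_zero_iff {j : F.ι} {x : Surface F ξ} (hx : x ∈ V F ξ j) :
    theta F ξ j x = 0 ↔ x ∈ Y F ξ := by
  rw [mem_Y_iff (j := j), theta]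
  have h := hx.2
  revert h
  generalize eta F ξ j x = v
  intro h
  induction v using OnePoint.rec with
  | infty => simp
  | coe z =>
    have hz : z ≠ 0 := fun h' => h (by rw [h'])
    rw [ProjLine.theta_coe]
    exact iff_of_false (inv_ne_zero hz) (OnePoint.coe_ne_infty _)

theorem mem_V_of_mem_Y {j : F.ι} {x : Surface F ξ} (hx : x ∈ Y F ξ) (hj : proj F ξ x ∈ F.dom j) :
    x ∈ V F ξ j := ⟨hj, by rw [mem_Y_iff.1 hx]; simp⟩

/-- The relation `θ_j = θ_k / (a_{jk} + ξ_{jk} θ_k)`. -/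
theorem theta_change {j k : F.ι} {x : Surface F ξ} (hj : x ∈ V F ξ j) (hk : x ∈ V F ξ k) :
    F.g j k (proj F ξ x) + coeff F ξ j k (proj F ξ x) * theta F ξ k x ≠ 0 ∧
    theta F ξ j x = theta F ξ k x /
      (F.g j k (proj F ξ x) + coeff F ξ j k (proj F ξ x) * theta F ξ k x) := by
  have h := eta_change hj.1 hk.1
  have h2 := ProjLine.theta_affine (b := coeff F ξ j k (proj F ξ x))
    (F.ne_zero j k _ hj.1 hk.1) hk.2 (h ▸ hj.2)
  rw [← h] at h2
  exact h2

variable (F ξ)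

theorem isOpen_compl_Y : IsOpen (Y F ξ)ᶜ := by
  rw [isOpen_iff_mem_nhds]
  intro x hx
  obtain ⟨j, hj⟩ := F.cover (proj F ξ x)
  have h := (triv F ξ j).isOpen_inter_preimage (s := univ ×ˢ {v | v ≠ OnePoint.infty})
    (isOpen_univ.prod isOpen_ne)
  rw [triv_source] at h
  refine Filter.mem_of_superset (h.mem_nhds ⟨hj, trivial, ?_⟩) ?_
  · exact fun h' => hx (mem_Y_iff.2 h')
  · rintro z ⟨-, -, hz⟩ hzY
    exact hz (mem_Y_iff.1 hzY)

variable [IsManifold 𝓘(ℂ) ω R]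

theorem contMDiffOn_bigChart (j : F.ι) (c : OpenPartialHomeomorph R ℂ) (hc : c ∈ atlas ℂ R)
    (b : Bool) : ContMDiffOn 𝓘(ℂ, ℂ × ℂ) 𝓘(ℂ, ℂ × ℂ) ω (bigChart F ξ j c b)
      (bigChart F ξ j c b).source :=
  contMDiffOn_of_mem_maximalAtlas (IsManifold.subset_maximalAtlas ⟨j, c, hc, b, rfl⟩)

/-- The projection `p` is holomorphic. -/
theorem contMDiff_proj : ContMDiff 𝓘(ℂ, ℂ × ℂ) 𝓘(ℂ) ω (proj F ξ) := by
  intro x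
  obtain ⟨j, hj⟩ := F.cover (proj F ξ x)
  obtain ⟨b, hb⟩ := exists_chart F ξ j x
  set c := chartAt ℂ (proj F ξ x)
  have hc : c ∈ atlas ℂ R := chart_mem_atlas ℂ _
  have hx : x ∈ (bigChart F ξ j c b).source := by
    rw [bigChart_source]
    exact ⟨hj, mem_chart_source ℂ _, hb⟩
  have h1 : ContMDiffOn 𝓘(ℂ, ℂ × ℂ) 𝓘(ℂ) ω (fun z => c.symm (bigChart F ξ j c b z).1)
      (bigChart F ξ j c b).source :=
    ((contMDiffOn_symm_of_mem_maximalAtlas (IsManifold.subset_maximalAtlas hc)).comp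
      (contMDiff_iff_contDiff.2 contDiff_fst).contMDiffOn (t := c.target)
        (s := {q : ℂ × ℂ | q.1 ∈ c.target}) (fun q hq => hq)).comp
      (contMDiffOn_bigChart F ξ j c hc b) (fun z hz => by
        rw [bigChart_source] at hz
        exact c.map_source hz.2.1)
  have h2 := h1.contMDiffAt ((bigChart F ξ j c b).open_source.mem_nhds hx)
  refine h2.congr_of_eventuallyEq ?_
  filter_upwards [(bigChart F ξ j c b).open_source.mem_nhds hx] with z hz
  rw [bigChart_source] at hz
  exact (c.left_inv hz.2.1).symm


/-- `θ_j` is holomorphic on `V j`. -/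
theorem hol_theta (j : F.ι) : IsHol (ℂ × ℂ) (V F ξ j) (theta F ξ j) := by
  intro x hx
  set c := chartAt ℂ (proj F ξ x)
  have hc : c ∈ atlas ℂ R := chart_mem_atlas ℂ _
  have hx' : x ∈ (bigChart F ξ j c true).source := by
    rw [bigChart_source]
    exact ⟨hx.1, mem_chart_source ℂ _, hx.2⟩
  have h1 : ContMDiffOn 𝓘(ℂ, ℂ × ℂ) 𝓘(ℂ) ω (fun z => (bigChart F ξ j c true z).2)
      (bigChart F ξ j c true).source :=
    (contMDiff_iff_contDiff.2 contDiff_snd).comp_contMDiffOn (contMDiffOn_bigChart F ξ j c hc true)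
  exact (h1.contMDiffAt ((bigChart F ξ j c true).open_source.mem_nhds hx')).contMDiffWithinAt

/-- The transition functions `θ_j / θ_k = 1 / (a_{jk} + ξ_{jk} θ_k)` (on `V j ∩ V k`) of the local
equations `θ_j` on `V j` and `1` on `X ∖ Y` (index `none`) of the curve `Y`. -/
noncomputable def transY : Option F.ι → Option F.ι → Surface F ξ → ℂ
  | some j, some k => fun x =>
      (F.g j k (proj F ξ x) + coeff F ξ j k (proj F ξ x) * theta F ξ k x)⁻¹
  | some j, none => theta F ξ j
  | none, some k => fun x => (theta F ξ k x)⁻¹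
  | none, none => fun _ => 1

/-- The open sets `V j` and `X ∖ Y`. -/
noncomputable def domY : Option F.ι → Opens (Surface F ξ)
  | some j => V F ξ j
  | none => ⟨(Y F ξ)ᶜ, isOpen_compl_Y F ξ⟩

/-- The local equations of `Y`: `θ_j` on `V j`, and `1` on `X ∖ Y`. -/
noncomputable def eqY : Option F.ι → Surface F ξ → ℂ
  | some j => theta F ξ j
  | none => fun _ => 1

/-- The line bundle `[Y]` of the divisor `Y`, with transition functions the quotients of the local
equations of `Y`; these local equations form its canonical section. -/
noncomputable def bundleY : HolLineBundle (ℂ × ℂ) (Surface F ξ) where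
  ι := Option F.ι
  dom := domY F ξ
  cover x := by
    by_cases hx : x ∈ Y F ξ
    · obtain ⟨j, hj⟩ := F.cover (proj F ξ x)
      exact ⟨some j, mem_V_of_mem_Y hx hj⟩
    · exact ⟨none, hx⟩
  g := transY F ξ
  hol i j := by
    rcases i with _ | i <;> rcases j with _ | j
    · exact IsHol.const 1
    · exact ((hol_theta F ξ j).mono inf_le_right).inv
        fun x hx h => hx.1 ((theta_eq_zero_iff hx.2).1 h)
    · exact (hol_theta F ξ i).mono inf_le_left
    · refine IsHol.inv (((F.hol i j).comp (contMDiff_proj F ξ) fun x hx => ?_).add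
        (((coeff_hol F ξ i j).comp (contMDiff_proj F ξ) fun x hx => ?_).mul
          ((hol_theta F ξ j).mono inf_le_right))) fun x hx => (theta_change hx.1 hx.2).1
      · exact ⟨hx.1.1, hx.2.1⟩
      · exact ⟨hx.1.1, hx.2.1⟩
  ne_zero i j x hi hj := by
    rcases i with _ | i <;> rcases j with _ | j
    · exact one_ne_zero
    · exact inv_ne_zero fun h => hi ((theta_eq_zero_iff hj).1 h)
    · exact fun h => hj ((theta_eq_zero_iff hi).1 h)
    · exact inv_ne_zero (theta_change hi hj).1
  cocycle i j k x hi hj hk := by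
    rcases i with _ | i <;> rcases j with _ | j <;> rcases k with _ | k <;>
      simp only [transY]
    · simp
    · simp
    · exact inv_mul_cancel₀ fun h => hi ((theta_eq_zero_iff hj).1 h)
    · have h1 := theta_change hj hk
      rw [h1.2, inv_div]
      have h3 : theta F ξ k x ≠ 0 := fun h => hi ((theta_eq_zero_iff hk).1 h)
      field_simp [h1.1]
    · simp
    · have h1 := theta_change hi hk
      rw [h1.2, div_eq_mul_inv, mul_comm, ← mul_assoc]
      have h3 : theta F ξ k x ≠ 0 := fun h => hj ((theta_eq_zero_iff hk).1 h)
      rw [inv_mul_cancel₀ h3, one_mul]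
    · have h1 := theta_change hi hj
      rw [h1.2, div_eq_mul_inv, mul_comm]
    · have h1 := theta_change hi hj
      have h2 := theta_change hj hk
      have h3 := theta_change hi hk
      rw [← mul_inv]
      congr 1
      have h4 := h2.1
      have h5 : theta F ξ j x * (F.g j k (proj F ξ x) +
          coeff F ξ j k (proj F ξ x) * theta F ξ k x) = theta F ξ k x := by
        rw [h2.2, div_mul_cancel₀ _ h4]
      rw [← F.cocycle i j k _ hi.1 hj.1 hk.1, ← coeff_cocycle F ξ i j k _ hi.1 hj.1 hk.1]
      linear_combination coeff F ξ i j (proj F ξ x) * h5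

/-- The line bundle `L = p^*F ⊗ [Y]`. -/
noncomputable def bundleL : HolLineBundle (ℂ × ℂ) (Surface F ξ) :=
  (F.pullback (proj F ξ) (contMDiff_proj F ξ)).tensor (bundleY F ξ)

/-- The frame `p^*m_j` of `p^*F` over `p⁻¹(U j)`. -/
noncomputable def framePullback (j : F.ι) :
    ∀ x, (F.pullback (proj F ξ) (contMDiff_proj F ξ)).fiber x :=
  (F.pullback (proj F ξ) (contMDiff_proj F ξ)).frame j

/-- The frame `e_j = p^*m_j ⊗ v_j` of `L` over `V j`, where `v_j` is the frame of `[Y]` over `V j`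
with `v_j θ_j` the canonical section. -/
noncomputable def frameL (j : F.ι) : ∀ x, (bundleL F ξ).fiber x :=
  fun x => HolLineBundle.tmul (framePullback F ξ j x) ((bundleY F ξ).frame (some j) x)

end Grauert

/-!
Fix local data `θ_j`, `e_j`, `t_{jk}`.  Since `e_k / e_j` equals the constant `t_{jk}` on `Y`, the
expansion of `t_{jk}⁻¹ e_k / e_j` says that `f_{jk} dθ_j` is the logarithmic differential
`dlog (e_k / e_j)` at the points of `Y` (`ObstructionSystem.cochain_val_eq_dlog`).  The cocycle
relation is the multiplicativity of the quotients of frames.  For a second system of frames `e'_a`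
the two cocycles differ by the coboundary of the family `dlog (e'_a / e_j)`
(`ObstructionSystem.cohClass_eq`), and these covectors are conormal as soon as `e'_a / e_j` is
locally constant along `Y`.  That is where `t_{jk} ∈ U(1)` and the compactness of `Y ≅ R` enter: the
modulus of `e'_a / e_j` is a global function on `Y`, hence constant by the maximum principle
(`Grauert.quot_frame_locally_const`).

For the frames `e_j = p^*m_j ⊗ v_j` the quotient `e_k / e_j = a_{jk} / (a_{jk} + ξ_{jk} θ_k)` equals
`1 - ξ_{jk} θ_j` with no remainder (`Grauert.frameL_eq_smul`), so they compute the class as that of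
`-ξ_{jk} dθ_j`.  A holomorphic function vanishing on `Y` has differential `g dθ_j` along `Y` with
`g` holomorphic (`Grauert.exists_mvfderiv_eq_smul_theta`), and `dθ_j = a_{jk}⁻¹ dθ_k` on `Y`; hence
`dθ_j ↦ p^*m_j` is an isomorphism of the conormal sheaf with `(p|_Y)^*F`.  It takes the obstruction
cocycle to the pullback of `-ξ` (`Grauert.conormalEquiv_cochain`), and pulling back along the
section at infinity `R → Y` identifies the two coboundary conditions.  Finally the class in
`H¹(Y, N⁻¹)` vanishes only if the cocycle is a coboundary on the given covering, because
`Ȟ¹(W, 𝓕) → H¹(T, 𝓕)` is injective for every covering (`SectionSheaf.toH1_cechClass_eq_zero_iff`).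
-/

/-! ### Čech classes under refinement -/

namespace SectionSheaf

variable {T : Type u} [TopologicalSpace T] {M : T → Type v} [∀ t, AddCommGroup (M t)]
  (𝓕 : SectionSheaf T M) {ι : Type w} {κ : Type*}

theorem cechClass_eq_zero_iff {W : ι → Opens T} (c : 𝓕.Z1 W) :
    𝓕.cechClass W c = 0 ↔ ∃ b : ι → ∀ t, M t, (∀ j, b j ∈ 𝓕.sec (W j)) ∧
      ∀ j k t, t ∈ W j → t ∈ W k → c.1 j k t = b k t - b j t :=
  QuotientAddGroup.eq_zero_iff c

theorem refineH1_cechClass (W : ι → Opens T) (W' : κ → Opens T) (ρ : κ → ι)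
    (h : ∀ a, W' a ≤ W (ρ a)) (c : 𝓕.Z1 W) :
    𝓕.refineH1 W W' ρ h (𝓕.cechClass W c) = 𝓕.cechClass W' (𝓕.refineZ1 W W' ρ h c) :=
  rfl

theorem ofPointCover_refineH1 (W W' : PointCover T) (h : ∀ t, W'.1 t ≤ W.1 t)
    (z : 𝓕.CechH1 W.1) :
    𝓕.ofPointCover W' (𝓕.refineH1 W.1 W'.1 id h z) = 𝓕.ofPointCover W z := by
  classical
  exact AddCommGroup.DirectLimit.of_f (ι := (PointCover T)ᵒᵈ)
    (G := fun W => 𝓕.CechH1 (OrderDual.ofDual W).1) (f := 𝓕.transition)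
    (i := OrderDual.toDual W) (j := OrderDual.toDual W') h z

/-- Two cocycles on different coverings define the same class in `H¹` as soon as they become
cohomologous on a common refinement by a point-indexed covering. -/
theorem toH1_eq_of_refinement {W : ι → Opens T} {W' : κ → Opens T} (hW : ∀ t, ∃ j, t ∈ W j)
    (hW' : ∀ t, ∃ j, t ∈ W' j) (c : 𝓕.Z1 W) (c' : 𝓕.Z1 W')
    (h : ∀ (ρ : T → ι) (ρ' : T → κ), ∃ b : T → ∀ t, M t,
      (∀ x, b x ∈ 𝓕.sec (W (ρ x) ⊓ W' (ρ' x))) ∧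
      ∀ x y t, t ∈ W (ρ x) ⊓ W' (ρ' x) → t ∈ W (ρ y) ⊓ W' (ρ' y) →
        c'.1 (ρ' x) (ρ' y) t - c.1 (ρ x) (ρ y) t = b y t - b x t) :
    𝓕.toH1 W hW (𝓕.cechClass W c) = 𝓕.toH1 W' hW' (𝓕.cechClass W' c') := by
  set ρ : T → ι := fun t => (hW t).choose
  set ρ' : T → κ := fun t => (hW' t).choose
  let W₁ : PointCover T := ⟨fun t => W (ρ t), fun t => (hW t).choose_spec⟩
  let W₂ : PointCover T := ⟨fun t => W' (ρ' t), fun t => (hW' t).choose_spec⟩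
  let W₃ : PointCover T := ⟨fun t => W (ρ t) ⊓ W' (ρ' t), fun t => ⟨W₁.2 t, W₂.2 t⟩⟩
  have e1 : 𝓕.toH1 W hW (𝓕.cechClass W c) =
      𝓕.ofPointCover W₁ (𝓕.cechClass W₁.1 (𝓕.refineZ1 W W₁.1 ρ (fun _ => le_rfl) c)) := rfl
  have e2 : 𝓕.toH1 W' hW' (𝓕.cechClass W' c') =
      𝓕.ofPointCover W₂ (𝓕.cechClass W₂.1 (𝓕.refineZ1 W' W₂.1 ρ' (fun _ => le_rfl) c')) := rfl
  rw [e1, e2, ← 𝓕.ofPointCover_refineH1 W₁ W₃ (fun _ => inf_le_left),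
    ← 𝓕.ofPointCover_refineH1 W₂ W₃ (fun _ => inf_le_right), refineH1_cechClass,
    refineH1_cechClass]
  congr 1
  rw [eq_comm, ← sub_eq_zero, ← map_sub, cechClass_eq_zero_iff]
  exact h ρ ρ'

instance directedSystem_transition : DirectedSystem
    (fun W : (PointCover T)ᵒᵈ => 𝓕.CechH1 (OrderDual.ofDual W).1)
    (fun W W' h => 𝓕.transition W W' h) where
  map_self W z := by
    obtain ⟨c, rfl⟩ := QuotientAddGroup.mk_surjective z
    rfl
  map_map W W' W'' h h' z := by
    obtain ⟨c, rfl⟩ := QuotientAddGroup.mk_surjective z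
    rfl

instance isDirectedOrder_pointCover : IsDirectedOrder (PointCover T)ᵒᵈ where
  directed W W' := ⟨OrderDual.toDual ⟨fun t => (OrderDual.ofDual W).1 t ⊓ (OrderDual.ofDual W').1 t,
    fun t => ⟨(OrderDual.ofDual W).2 t, (OrderDual.ofDual W').2 t⟩⟩,
    show (fun t => (OrderDual.ofDual W).1 t ⊓ (OrderDual.ofDual W').1 t) ≤
      (OrderDual.ofDual W).1 from fun _ => inf_le_left,
    show (fun t => (OrderDual.ofDual W).1 t ⊓ (OrderDual.ofDual W').1 t) ≤
      (OrderDual.ofDual W').1 from fun _ => inf_le_right⟩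

/-- A cocycle which becomes a coboundary on a refinement is a coboundary: if
`c (ρ a) (ρ a') = b a' - b a` on a refinement `W'` of `W`, the sections `b a + c (ρ a) j` over
`W' a ∩ W j` glue to sections over `W j`. -/
theorem cechClass_eq_zero_of_refine {W : ι → Opens T} {W' : κ → Opens T}
    (hW' : ∀ t, ∃ a, t ∈ W' a) (ρ : κ → ι) (h : ∀ a, W' a ≤ W (ρ a)) (c : 𝓕.Z1 W)
    (hc : 𝓕.cechClass W' (𝓕.refineZ1 W W' ρ h c) = 0) : 𝓕.cechClass W c = 0 := by
  rw [cechClass_eq_zero_iff] at hc ⊢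
  obtain ⟨b, hb, hb'⟩ := hc
  have hb2 : ∀ a a' t, t ∈ W' a → t ∈ W' a' → c.1 (ρ a) (ρ a') t = b a' t - b a t := hb'
  choose α hα using hW'
  have key : ∀ j a t, t ∈ W' a → t ∈ W j →
      b (α t) t + c.1 (ρ (α t)) j t = b a t + c.1 (ρ a) j t := by
    intro j a t ha hj
    have h1 := c.2.2 (ρ a) (ρ (α t)) j t (h _ ha) (h _ (hα t)) hj
    rw [hb2 a (α t) t ha (hα t)] at h1
    rw [← h1]
    abel
  refine ⟨fun j t => b (α t) t + c.1 (ρ (α t)) j t, fun j => 𝓕.local' _ _ fun t ht => ?_,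
    fun j k t hj hk => ?_⟩
  · refine ⟨W' (α t) ⊓ W j, ⟨hα t, ht⟩, inf_le_right, ?_⟩
    refine 𝓕.congr' _ (b (α t) + c.1 (ρ (α t)) j) _ (fun s hs => (key j (α t) s hs.1 hs.2).symm) ?_
    exact add_mem (𝓕.restrict' _ _ _ inf_le_left (hb _))
      (𝓕.restrict' _ _ _ (inf_le_inf_right _ (h _)) (c.2.1 _ _))
  · have h1 := c.2.2 (ρ (α t)) j k t (h _ (hα t)) hj hk
    change c.1 j k t = (b (α t) t + c.1 (ρ (α t)) k t) - (b (α t) t + c.1 (ρ (α t)) j t)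
    rw [← h1]
    abel

/-- The map `Ȟ¹(W, 𝓕) → H¹(T, 𝓕)` of an open covering is injective. -/
theorem toH1_cechClass_eq_zero_iff {W : ι → Opens T} (hW : ∀ t, ∃ j, t ∈ W j) (c : 𝓕.Z1 W) :
    𝓕.toH1 W hW (𝓕.cechClass W c) = 0 ↔ 𝓕.cechClass W c = 0 := by
  classical
  refine ⟨fun h => ?_, fun h => by rw [h, map_zero]⟩
  let W₁ : PointCover T := ⟨fun t => W (hW t).choose, fun t => (hW t).choose_spec⟩
  obtain ⟨W', h', hz⟩ := AddCommGroup.DirectLimit.of.zero_exact (ι := (PointCover T)ᵒᵈ)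
    (G := fun W => 𝓕.CechH1 (OrderDual.ofDual W).1) (f := 𝓕.transition)
    (OrderDual.toDual W₁) (𝓕.cechClass W₁.1
      (𝓕.refineZ1 W W₁.1 (fun t => (hW t).choose) (fun _ => le_rfl) c)) h
  refine 𝓕.cechClass_eq_zero_of_refine (W' := (OrderDual.ofDual W').1)
    (fun t => ⟨t, (OrderDual.ofDual W').2 t⟩) (fun t => (hW t).choose)
    (fun t => (show (OrderDual.ofDual W').1 ≤ W₁.1 from h') t) c hz

end SectionSheaf

/-! ### Quotients of sections of a line bundle -/

namespace HolLineBundle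

variable {E : Type*} [NormedAddCommGroup E] [NormedSpace ℂ E] {X : Type u}
  [TopologicalSpace X] [ChartedSpace E X] (L : HolLineBundle E X)

theorem fiber_apply_ne_zero {x : X} {v : L.fiber x} (hv : v ≠ 0) {i : L.ι} (hi : x ∈ L.dom i) :
    v.1 i ≠ 0 := by
  intro h
  apply hv
  ext j
  by_cases hj : x ∈ L.dom j
  · rw [v.2.2 j i hj hi, h, mul_zero]
    rfl
  · exact v.2.1 j hj

theorem quot_eq_div {x : X} (a b : L.fiber x) {i : L.ι} (hi : x ∈ L.dom i) :
    L.quot a b = a.1 i / b.1 i := by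
  have hj := (L.cover x).choose_spec
  rw [quot, a.2.2 _ i hj hi, b.2.2 _ i hj hi, mul_div_mul_left _ _ (L.ne_zero _ _ x hj hi)]

theorem quot_smul_left {x : X} (c : ℂ) (a b : L.fiber x) :
    L.quot (c • a) b = c * L.quot a b :=
  mul_div_assoc _ _ _

theorem quot_self {x : X} {a : L.fiber x} (ha : a ≠ 0) : L.quot a a = 1 :=
  div_self (L.fiber_apply_ne_zero ha (L.cover x).choose_spec)

theorem quot_mul_quot {x : X} (a : L.fiber x) {b : L.fiber x} (hb : b ≠ 0) (c : L.fiber x) :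
    L.quot a b * L.quot b c = L.quot a c :=
  div_mul_div_cancel₀ (L.fiber_apply_ne_zero hb (L.cover x).choose_spec)

theorem quot_ne_zero {x : X} {a b : L.fiber x} (ha : a ≠ 0) (hb : b ≠ 0) : L.quot a b ≠ 0 :=
  div_ne_zero (L.fiber_apply_ne_zero ha (L.cover x).choose_spec)
    (L.fiber_apply_ne_zero hb (L.cover x).choose_spec)

variable {L} in
theorem IsFrame.mono {U V : Opens X} {e : ∀ x, L.fiber x} (h : L.IsFrame U e) (hV : V ≤ U) :
    L.IsFrame V e :=
  ⟨fun i => (h.1 i).mono (inf_le_inf_right _ hV), fun x hx => h.2 x (hV hx)⟩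

variable {L} in
theorem IsFrame.isHol_quot {U : Opens X} {s e : ∀ x, L.fiber x} (he : L.IsFrame U e)
    (hs : L.IsHolSection U s) : IsHol E U (fun x => L.quot (s x) (e x)) := by
  refine IsHol.of_local fun x hx => ?_
  obtain ⟨i, hi⟩ := L.cover x
  refine ⟨U ⊓ L.dom i, ⟨hx, hi⟩, IsHol.congr ((hs i).mul ((he.1 i).inv fun z hz => ?_))
    fun z hz => ?_⟩
  · exact L.fiber_apply_ne_zero (he.2 z hz.1) hz.2
  · rw [L.quot_eq_div _ _ hz.2, div_eq_mul_inv]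

end HolLineBundle

/-! ### Differentials and logarithmic differentials -/

section LogDeriv

variable {E : Type*} [NormedAddCommGroup E] [NormedSpace ℂ E] {X : Type*}
  [TopologicalSpace X] [ChartedSpace E X]

theorem mvfderiv_congr_of_eventuallyEq {f g : X → ℂ} {x : X} (h : f =ᶠ[𝓝 x] g) :
    mvfderiv 𝓘(ℂ, E) f x = mvfderiv 𝓘(ℂ, E) g x := by
  have h1 := h.mfderiv_eq (I := 𝓘(ℂ, E)) (I' := 𝓘(ℂ, ℂ))
  ext v
  exact congrArg (fun A : E →L[ℂ] ℂ => A v) h1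

theorem mvfderiv_const_mul {f : X → ℂ} {x : X} (c : ℂ)
    (hf : MDifferentiableAt 𝓘(ℂ, E) 𝓘(ℂ, ℂ) f x) :
    mvfderiv 𝓘(ℂ, E) (fun z => c * f z) x = c • mvfderiv 𝓘(ℂ, E) f x := by
  have h : mvfderiv 𝓘(ℂ, E) (fun z => c * f z) x = _ :=
    mvfderiv_mul (f := fun _ => c) mdifferentiableAt_const hf
  rw [h, mvfderiv_const]
  simp

/-- The differential of a product `f g` at a zero of `g`. -/
theorem mvfderiv_mul_of_right_eq_zero {f g : X → ℂ} {x : X}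
    (hf : MDifferentiableAt 𝓘(ℂ, E) 𝓘(ℂ, ℂ) f x) (hg : MDifferentiableAt 𝓘(ℂ, E) 𝓘(ℂ, ℂ) g x)
    (h0 : g x = 0) :
    mvfderiv 𝓘(ℂ, E) (fun z => f z * g z) x = f x • mvfderiv 𝓘(ℂ, E) g x := by
  have h : mvfderiv 𝓘(ℂ, E) (fun z => f z * g z) x = _ := mvfderiv_mul hf hg
  rw [h, h0]
  simp

theorem mvfderiv_eq_fderiv {E : Type*} [NormedAddCommGroup E] [NormedSpace ℂ E] (f : E → ℂ)
    (x v : E) : mvfderiv 𝓘(ℂ, E) f x v = fderiv ℂ f x v :=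
  DFunLike.congr_fun (mfderiv_eq_fderiv (𝕜 := ℂ) (f := f) (x := x)) v

theorem mvfderiv_snd (x v : ℂ × ℂ) :
    mvfderiv 𝓘(ℂ, ℂ × ℂ) (fun q : ℂ × ℂ => q.2) x v = v.2 := by
  rw [mvfderiv_eq_fderiv, hasFDerivAt_snd.fderiv]
  rfl

/-- A function which is `O(θ²)` at a zero of a differentiable function `θ` has differential zero
there. -/
theorem mvfderiv_eq_zero_of_isBigO_sq {f θ : X → ℂ} {x : X}
    (hf : MDifferentiableAt 𝓘(ℂ, E) 𝓘(ℂ, ℂ) f x) (hθ : MDifferentiableAt 𝓘(ℂ, E) 𝓘(ℂ, ℂ) θ x)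
    (h0 : θ x = 0) (h : f =O[𝓝 x] fun z => θ z ^ 2) : mvfderiv 𝓘(ℂ, E) f x = 0 := by
  set ψ := extChartAt 𝓘(ℂ, E) x
  have hx : ψ.symm (ψ x) = x := extChartAt_to_inv x
  have hcont : Tendsto ψ.symm (𝓝 (ψ x)) (𝓝 x) := by
    have := continuousAt_extChartAt_symm (I := 𝓘(ℂ, E)) x
    rwa [ContinuousAt, hx] at this
  have hf0 : f x = 0 := by
    have := h.eq_zero_imp.self_of_nhds
    exact this (by rw [h0]; simp)
  obtain ⟨D, hD⟩ : ∃ D : E →L[ℂ] ℂ,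
      HasFDerivWithinAt (θ ∘ ψ.symm) D (range 𝓘(ℂ, E)) (ψ x) := ⟨_, hθ.hasMFDerivAt.2⟩
  have hd : HasFDerivAt (θ ∘ ψ.symm) D (ψ x) := by
    rwa [modelWithCornersSelf_coe, range_id, hasFDerivWithinAt_univ] at hD
  have hO : (θ ∘ ψ.symm) =O[𝓝 (ψ x)] fun z => z - ψ x :=
    hd.isBigO_sub.congr_left fun z => by
      rw [Function.comp_apply, Function.comp_apply, hx, h0, sub_zero]
  have h2 : (f ∘ ψ.symm) =O[𝓝 (ψ x)] fun z => ‖z - ψ x‖ ^ 2 :=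
    (h.comp_tendsto hcont).trans ((hO.norm_right.pow 2))
  have h3 : HasFDerivAt (f ∘ ψ.symm) (0 : E →L[ℂ] ℂ) (ψ x) := by
    rw [hasFDerivAt_iff_isLittleO]
    have h4 : (fun z : E => ‖z - ψ x‖ ^ 2) =o[𝓝 (ψ x)] fun z => z - ψ x :=
      Asymptotics.isLittleO_pow_sub_sub (ψ x) one_lt_two
    refine (h2.trans_isLittleO h4).congr_left fun z => ?_
    simp [hx, hf0]
  have h4 : HasFDerivWithinAt (f ∘ ψ.symm) (0 : E →L[ℂ] ℂ) (range 𝓘(ℂ, E)) (ψ x) :=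
    h3.hasFDerivWithinAt
  have h5 : HasMFDerivAt 𝓘(ℂ, E) 𝓘(ℂ, ℂ) f x (0 : E →L[ℂ] ℂ) := ⟨hf.continuousAt, h4⟩
  ext v
  exact congrArg (fun A : E →L[ℂ] ℂ => A v) h5.mfderiv

variable (E) in
/-- The logarithmic differential `df / f` at the point `x` (zero if `f x = 0`). -/
noncomputable def dlog (f : X → ℂ) (x : X) : TangentSpace 𝓘(ℂ, E) x →L[ℂ] ℂ :=
  (f x)⁻¹ • mvfderiv 𝓘(ℂ, E) f x

theorem dlog_congr {f g : X → ℂ} {x : X} (h : f =ᶠ[𝓝 x] g) : dlog E f x = dlog E g x := by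
  rw [dlog, dlog, mvfderiv_congr_of_eventuallyEq h, h.eq_of_nhds]

theorem dlog_mul {f g : X → ℂ} {x : X} (hf : MDifferentiableAt 𝓘(ℂ, E) 𝓘(ℂ, ℂ) f x)
    (hg : MDifferentiableAt 𝓘(ℂ, E) 𝓘(ℂ, ℂ) g x) (hf0 : f x ≠ 0) (hg0 : g x ≠ 0) :
    dlog E (fun z => f z * g z) x = dlog E f x + dlog E g x := by
  have h : mvfderiv 𝓘(ℂ, E) (fun z => f z * g z) x = _ := mvfderiv_mul hf hg
  rw [dlog, dlog, dlog, h, smul_add, smul_smul, smul_smul, mul_inv, add_comm]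
  congr 2
  · field_simp
  · field_simp

theorem dlog_const_mul {f : X → ℂ} {x : X} {c : ℂ} (hc : c ≠ 0)
    (hf : MDifferentiableAt 𝓘(ℂ, E) 𝓘(ℂ, ℂ) f x) :
    dlog E (fun z => c * f z) x = dlog E f x := by
  rw [dlog, dlog, mvfderiv_const_mul c hf, smul_smul]
  congr 1
  field_simp

end LogDeriv

/-! ### Independence of the obstruction class of the local data -/

section Obstruction

variable {E : Type*} [NormedAddCommGroup E] [NormedSpace ℂ E] {X : Type u}
  [TopologicalSpace X] [ChartedSpace E X] {Y : Set X} {L : HolLineBundle E X}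

/-- If a nonvanishing holomorphic function is locally constant along `Y`, its logarithmic
differential is conormal at the points of `Y`. -/
theorem dlog_mem_conormalSpace {O : Opens X} {h : X → ℂ} (hh : IsHol E O h)
    (h0 : ∀ z ∈ O, h z ≠ 0)
    (hloc : ∀ y ∈ O, y ∈ Y → ∀ᶠ z in 𝓝[Y] y, h z = h y) {y : X} (hy : y ∈ O) (hyY : y ∈ Y) :
    ∃ O' : Opens X, y ∈ O' ∧ ∃ φ : X → ℂ, IsHol E O' φ ∧ (∀ z ∈ O', z ∈ Y → φ z = 0) ∧
      ∀ z ∈ O', z ∈ Y → dlog E h z = mvfderiv 𝓘(ℂ, E) φ z := by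
  obtain ⟨N, hN, hNY⟩ := mem_nhdsWithin_iff_exists_mem_nhds_inter.1 (hloc y hy hyY)
  obtain ⟨N', hN'N, hN'o, hyN'⟩ := mem_nhds_iff.1 hN
  let O' : Opens X := O ⊓ ⟨N', hN'o⟩
  have hc : ∀ z ∈ O', z ∈ Y → h z = h y := fun z hz hzY => hNY ⟨hN'N hz.2, hzY⟩
  have hh' : IsHol E O' (fun z => (h y)⁻¹ * h z) := (IsHol.const _).mul (hh.mono inf_le_left)
  -- near `y` the covectors are the differentials of `h / h y - 1`, which vanishes on `Y`
  refine ⟨O', ⟨hy, hyN'⟩, fun z => (h y)⁻¹ * h z + (-1), hh'.add (IsHol.const _),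
    fun z hz hzY => ?_, fun z hz hzY => ?_⟩
  · change (h y)⁻¹ * h z + (-1) = 0
    rw [hc z hz hzY, inv_mul_cancel₀ (h0 y hy)]
    ring
  · have e1 : mvfderiv 𝓘(ℂ, E) (fun z => (h y)⁻¹ * h z + (-1)) z = _ :=
      mvfderiv_add (hh'.mdifferentiableAt hz) (g' := fun _ => -1) mdifferentiableAt_const
    rw [e1, mvfderiv_const, add_zero, mvfderiv_const_mul _ (hh.mdifferentiableAt hz.1), dlog,
      hc z hz hzY]

namespace ObstructionSystem

variable {ι κ : Type u} (S : ObstructionSystem ι Y L) (S' : ObstructionSystem κ Y L)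

theorem quot_frame_eq {j k : ι} {y : X} (hy : y ∈ Y) (hj : y ∈ S.V j) (hk : y ∈ S.V k) :
    L.quot (S.e k y) (S.e j y) = S.t j k := by
  have h1 : L.quot ((S.t j k : ℂ)⁻¹ • S.e k y) (S.e j y) = 1 := by
    rw [S.flat j k y hy hj hk]
    exact L.quot_self ((S.frame j).2 y hj)
  rw [L.quot_smul_left] at h1
  exact (inv_mul_eq_one₀ (Circle.coe_ne_zero _)).1 h1 |>.symm

theorem isHol_quot_frame (j : ι) (a : κ) :
    IsHol E (S.V j ⊓ S'.V a) (fun x => L.quot (S'.e a x) (S.e j x)) :=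
  ((S.frame j).mono inf_le_left).isHol_quot ((S'.frame a).mono inf_le_right).1

theorem cochain_val_eq_smul {j k : ι} {y : Y} (hj : y.1 ∈ S.V j) (hk : y.1 ∈ S.V k) :
    (S.cochain j k y).1 = S.f j k y.1 • mvfderiv 𝓘(ℂ, E) (S.θ j) y.1 := by
  rw [cochain, dif_pos ⟨hj, hk⟩]
  rfl

/-- The cochain `f j k dθ j` is the logarithmic differential along `Y` of the transition functions
`e k / e j` of the frames.  From this the cocycle relation and the independence of the choices
follow. -/
theorem cochain_val_eq_dlog {j k : ι} {y : Y} (hj : y.1 ∈ S.V j) (hk : y.1 ∈ S.V k) :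
    (S.cochain j k y).1 = dlog E (fun x => L.quot (S.e k x) (S.e j x)) y.1 := by
  have hr := (S.isHol_quot_frame S j k).mdifferentiableAt (x := y.1) ⟨hj, hk⟩
  have ht : (S.t j k : ℂ)⁻¹ ≠ 0 := inv_ne_zero (Circle.coe_ne_zero _)
  have hθ := (S.defining j).1.mdifferentiableAt hj
  have hf := (S.hol j k).mdifferentiableAt (x := y.1) ⟨hj, hk⟩
  have h0 : S.θ j y.1 = 0 := ((S.defining j).2.1 _ hj).1 y.2
  have hq := IsHol.mdifferentiableAt ((IsHol.const (S.t j k : ℂ)⁻¹).mul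
    (S.isHol_quot_frame S j k)) (x := y.1) ⟨hj, hk⟩
  have hft : MDifferentiableAt 𝓘(ℂ, E) 𝓘(ℂ, ℂ) (fun x => f S j k x * S.θ j x) y.1 := hf.mul hθ
  have hft1 : MDifferentiableAt 𝓘(ℂ, E) 𝓘(ℂ, ℂ) (fun x => 1 + f S j k x * S.θ j x) y.1 :=
    mdifferentiableAt_const.add hft
  have hexp := S.expansion j k y.1 y.2 hj hk
  simp only [L.quot_smul_left] at hexp
  have h1 := mvfderiv_eq_zero_of_isBigO_sq (hq.sub hft1) hθ h0 hexp
  have h2 := mvfderiv_sub hq hft1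
  have h3 : mvfderiv 𝓘(ℂ, E) (fun x => 1 + f S j k x * S.θ j x) y.1 = _ :=
    mvfderiv_add (g := fun _ => 1) mdifferentiableAt_const hft
  rw [← dlog_const_mul ht hr, S.cochain_val_eq_smul hj hk, dlog, S.quot_frame_eq y.2 hj hk,
    inv_mul_cancel₀ (Circle.coe_ne_zero _), inv_one, one_smul,
    sub_eq_zero.1 (h2.symm.trans h1), h3, mvfderiv_const, zero_add,
    mvfderiv_mul_of_right_eq_zero hf hθ h0]

/-- Comparison of the frames of two systems: the identity
`(e' b / e' a) (e' a / e j) = (e' b / e k) (e k / e j)` in logarithmic form. -/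
theorem cochain_sub_cochain {j k : ι} {a b : κ} {y : Y} (hj : y.1 ∈ S.V j) (hk : y.1 ∈ S.V k)
    (ha : y.1 ∈ S'.V a) (hb : y.1 ∈ S'.V b) :
    (S'.cochain a b y).1 - (S.cochain j k y).1 =
      dlog E (fun x => L.quot (S'.e b x) (S.e k x)) y.1 -
        dlog E (fun x => L.quot (S'.e a x) (S.e j x)) y.1 := by
  have d1 := (S'.isHol_quot_frame S' a b).mdifferentiableAt (x := y.1) ⟨ha, hb⟩
  have d2 := (S.isHol_quot_frame S' j a).mdifferentiableAt (x := y.1) ⟨hj, ha⟩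
  have d3 := (S.isHol_quot_frame S' k b).mdifferentiableAt (x := y.1) ⟨hk, hb⟩
  have d4 := (S.isHol_quot_frame S j k).mdifferentiableAt (x := y.1) ⟨hj, hk⟩
  have nj := (S.frame j).2 y.1 hj
  have nk := (S.frame k).2 y.1 hk
  have na := (S'.frame a).2 y.1 ha
  have nb := (S'.frame b).2 y.1 hb
  rw [S'.cochain_val_eq_dlog ha hb, S.cochain_val_eq_dlog hj hk, sub_eq_sub_iff_add_eq_add,
    ← dlog_mul d1 d2 (L.quot_ne_zero nb na) (L.quot_ne_zero na nj),
    ← dlog_mul d3 d4 (L.quot_ne_zero nb nk) (L.quot_ne_zero nk nj)]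
  apply dlog_congr
  filter_upwards [(S'.V a).isOpen.mem_nhds ha, (S.V k).isOpen.mem_nhds hk] with z hza hzk
  rw [L.quot_mul_quot _ ((S'.frame a).2 z hza), L.quot_mul_quot _ ((S.frame k).2 z hzk)]

theorem cochain_mem_Z1 : S.cochain ∈ (conormalSheaf E Y).Z1 S.W := by
  refine ⟨fun j k y hy => ?_, fun j k l y hj hk hl => ?_⟩
  · refine ⟨S.V j ⊓ S.V k, hy, fun z => S.f j k z * S.θ j z,
      (S.hol j k).mul ((S.defining j).1.mono inf_le_left), fun z hz hzY => ?_, fun z hz hzO => ?_⟩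
    · change S.f j k z * S.θ j z = 0
      rw [((S.defining j).2.1 z hz.1).1 hzY, mul_zero]
    · rw [S.cochain_val_eq_smul hz.1 hz.2, mvfderiv_mul_of_right_eq_zero
        ((S.hol j k).mdifferentiableAt hzO) ((S.defining j).1.mdifferentiableAt hz.1)
        (((S.defining j).2.1 _ hz.1).1 z.2)]
  · apply Subtype.ext
    change y.1 ∈ S.V j at hj
    change y.1 ∈ S.V k at hk
    change y.1 ∈ S.V l at hl
    have hr := (S.isHol_quot_frame S j k).mdifferentiableAt (x := y.1) ⟨hj, hk⟩
    have hr' := (S.isHol_quot_frame S k l).mdifferentiableAt (x := y.1) ⟨hk, hl⟩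
    have nj := (S.frame j).2 y.1 hj
    have nk := (S.frame k).2 y.1 hk
    have nl := (S.frame l).2 y.1 hl
    change (S.cochain j k y).1 + (S.cochain k l y).1 = (S.cochain j l y).1
    rw [S.cochain_val_eq_dlog hj hk, S.cochain_val_eq_dlog hk hl, S.cochain_val_eq_dlog hj hl,
      add_comm, ← dlog_mul hr' hr (L.quot_ne_zero nl nk) (L.quot_ne_zero nk nj)]
    apply dlog_congr
    filter_upwards [(S.V k).isOpen.mem_nhds hk] with z hzk
    rw [L.quot_mul_quot _ ((S.frame k).2 z hzk)]

/-- Two systems of local data, whose frames have locally constant quotients along `Y`, define the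
same cohomology class: the cocycles differ by the coboundary of the conormal sections
`dlog (e' a / e j)`. -/
theorem cohClass_eq
    (hloc : ∀ (j : ι) (a : κ), ∀ y ∈ Y, y ∈ S.V j → y ∈ S'.V a →
      ∀ᶠ z in 𝓝[Y] y, L.quot (S'.e a z) (S.e j z) = L.quot (S'.e a y) (S.e j y)) :
    S.cohClass S.cochain_mem_Z1 = S'.cohClass S'.cochain_mem_Z1 := by
  classical
  have hdlog : ∀ (j : ι) (a : κ), ∀ y ∈ S.V j ⊓ S'.V a, y ∈ Y → _ := fun j a y hy hyY =>
    dlog_mem_conormalSpace (Y := Y) (S.isHol_quot_frame S' j a)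
      (fun z hz => L.quot_ne_zero ((S'.frame a).2 z hz.2) ((S.frame j).2 z hz.1))
      (fun y hy hyY => hloc j a y hyY hy.1 hy.2) hy hyY
  refine (conormalSheaf E Y).toH1_eq_of_refinement S.cover S'.cover _ _ fun ρ ρ' => ?_
  have hmem : ∀ (x y : Y), y.1 ∈ S.V (ρ x) ⊓ S'.V (ρ' x) →
      dlog E (fun z => L.quot (S'.e (ρ' x) z) (S.e (ρ x) z)) y.1 ∈ conormalSpace E Y y.1 := by
    intro x y h
    obtain ⟨O, hO, φ, h1, h2, h3⟩ := hdlog (ρ x) (ρ' x) y.1 h y.2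
    exact ⟨O, hO, φ, h1, h2, h3 _ hO y.2⟩
  obtain ⟨b, hb⟩ : ∃ b : Y → ∀ y : Y, conormalSpace E Y y.1, ∀ x y : Y,
      y.1 ∈ S.V (ρ x) ⊓ S'.V (ρ' x) →
      (b x y).1 = dlog E (fun z => L.quot (S'.e (ρ' x) z) (S.e (ρ x) z)) y.1 :=
    ⟨fun x y => if h : y.1 ∈ S.V (ρ x) ⊓ S'.V (ρ' x) then ⟨_, hmem x y h⟩ else 0,
      fun x y h => congrArg Subtype.val (dif_pos h)⟩
  refine ⟨b, fun x y hy => ?_, fun x x' y hy hy' => Subtype.ext ?_⟩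
  · obtain ⟨O, hO, φ, h1, h2, h3⟩ := hdlog (ρ x) (ρ' x) y.1 hy y.2
    exact ⟨O, hO, φ, h1, h2, fun z hz hzO => (hb x z hz).trans (h3 _ hzO z.2)⟩
  · change (S'.cochain (ρ' x) (ρ' x') y).1 - (S.cochain (ρ x) (ρ x') y).1 = (b x' y).1 - (b x y).1
    rw [hb x y hy, hb x' y hy']
    exact S.cochain_sub_cochain S' hy.1 hy'.1 hy.2 hy'.2

end ObstructionSystem

/-- If all systems of local data define the same class, this is the first obstruction class. -/
theorem firstObstructionClass_eq {ι : Type u} (S : ObstructionSystem ι Y L)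
    (h : ∀ (κ : Type u) (S' : ObstructionSystem κ Y L),
      S.cohClass S.cochain_mem_Z1 = S'.cohClass S'.cochain_mem_Z1) :
    firstObstructionClass Y L = S.cohClass S.cochain_mem_Z1 := by
  have hex : ∃ z : (conormalSheaf E Y).H1, ∃ (κ : Type u) (S' : ObstructionSystem κ Y L)
      (hS : S'.cochain ∈ (conormalSheaf E Y).Z1 S'.W), z = S'.cohClass hS :=
    ⟨_, ι, S, S.cochain_mem_Z1, rfl⟩
  rw [firstObstructionClass, dif_pos hex]
  obtain ⟨κ, S', hS, hz⟩ := hex.choose_spec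
  rw [hz, h κ S']

end Obstruction

/-! ### Holomorphic functions of locally constant modulus -/

/-- Near a point where its modulus is constant, a holomorphic function is constant: apply the
maximum principle to `f` and to `f + f c`. -/
theorem eventually_eq_of_norm_eventually_eq {E : Type*} [NormedAddCommGroup E] [NormedSpace ℂ E]
    {M : Type*} [TopologicalSpace M] [ChartedSpace E M] [IsManifold 𝓘(ℂ, E) 1 M] {f : M → ℂ}
    {c : M} (hd : ∀ᶠ z in 𝓝 c, MDifferentiableAt 𝓘(ℂ, E) 𝓘(ℂ, ℂ) f z)
    (hc : ∀ᶠ z in 𝓝 c, ‖f z‖ = ‖f c‖) : ∀ᶠ z in 𝓝 c, f z = f c := by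
  have hmax : IsLocalMax (norm ∘ f) c := hc.mono fun z hz => hz.le
  have hd' : ∀ᶠ z in 𝓝 c, MDifferentiableAt 𝓘(ℂ, E) 𝓘(ℂ, ℂ) (fun w => f w + f c) z :=
    hd.mono fun z hz => hz.add mdifferentiableAt_const
  filter_upwards [hc,
    Complex.norm_eventually_eq_of_mdifferentiableAt_of_isLocalMax hd' hmax.norm_add_self]
    with z h1 h2
  refine eq_of_norm_eq_of_norm_add_eq h1 ?_
  rw [h2, h1, SameRay.rfl.norm_add]

namespace Grauert

variable {R : Type u} [TopologicalSpace R] [ChartedSpace ℂ R]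
  (F : HolLineBundle ℂ R) (ξ : F.sheaf.Z1 F.dom)

/-! ### The section at infinity -/

/-- The section at infinity `R → X`, with image `Y`. -/
def secInfty (r : R) : Surface F ξ := ⟨r, (OnePoint.infty : OnePoint ℂ)⟩

variable {F ξ}

theorem eta_secInfty (j : F.ι) (r : R) : eta F ξ j (secInfty F ξ r) = OnePoint.infty :=
  eta_eq_infty_iff.2 rfl

theorem secInfty_mem_Y (r : R) : secInfty F ξ r ∈ Y F ξ := by
  obtain ⟨j, -⟩ := F.cover r
  exact (mem_Y_iff (j := j)).2 (eta_secInfty j r)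

theorem secInfty_proj {x : Surface F ξ} (hx : x ∈ Y F ξ) : secInfty F ξ (proj F ξ x) = x := by
  obtain ⟨j, -⟩ := F.cover (proj F ξ x)
  have h := eta_eq_infty_iff.1 ((mem_Y_iff (j := j)).1 hx)
  obtain ⟨r, v⟩ := x
  exact congrArg (fun w : OnePoint ℂ => (⟨r, w⟩ : Surface F ξ)) h.symm

theorem secInfty_mem_V {j : F.ι} {r : R} (hr : r ∈ F.dom j) : secInfty F ξ r ∈ V F ξ j :=
  mem_V_of_mem_Y (secInfty_mem_Y r) hr

theorem mem_bigChart_true_source {j : F.ι} {x : Surface F ξ} (hx : x ∈ V F ξ j) :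
    x ∈ (bigChart F ξ j (chartAt ℂ (proj F ξ x)) true).source := by
  rw [bigChart_source]
  exact ⟨hx.1, mem_chart_source ℂ _, hx.2⟩

theorem bigChart_true_snd (j : F.ι) (c : OpenPartialHomeomorph R ℂ) (x : Surface F ξ) :
    (bigChart F ξ j c true x).2 = theta F ξ j x := rfl

/-- In the coordinates `(c, θ_j)` the section at infinity is `t ↦ (c t, 0)`. -/
theorem bigChart_secInfty {j : F.ι} {c : OpenPartialHomeomorph R ℂ} {r : R}
    (hj : r ∈ F.dom j) (hc : r ∈ c.source) :
    secInfty F ξ r ∈ (bigChart F ξ j c true).source ∧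
      bigChart F ξ j c true (secInfty F ξ r) = (c r, 0) := by
  refine ⟨?_, ?_⟩
  · rw [bigChart_source]
    exact ⟨hj, hc, (secInfty_mem_V hj).2⟩
  · rw [bigChart_apply, eta_secInfty]
    rfl

variable [IsManifold 𝓘(ℂ) ω R]

variable (F ξ) in
theorem contMDiff_secInfty : ContMDiff 𝓘(ℂ) 𝓘(ℂ, ℂ × ℂ) ω (secInfty F ξ) := by
  intro r
  obtain ⟨j, hj⟩ := F.cover r
  set c := chartAt ℂ r
  have hc : c ∈ atlas ℂ R := chart_mem_atlas ℂ _
  have hO : IsOpen ((F.dom j : Set R) ∩ c.source) := (F.dom j).isOpen.inter c.open_source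
  have hr : r ∈ (F.dom j : Set R) ∩ c.source := ⟨hj, mem_chart_source ℂ r⟩
  have h1 : ContMDiffOn 𝓘(ℂ) 𝓘(ℂ, ℂ × ℂ) ω (fun t => ((c t, 0) : ℂ × ℂ))
      ((F.dom j : Set R) ∩ c.source) :=
    (contMDiff_iff_contDiff.2 (contDiff_prodMk_left (0 : ℂ))).comp_contMDiffOn
      ((contMDiffOn_of_mem_maximalAtlas (IsManifold.subset_maximalAtlas hc)).mono
        inter_subset_right)
  have h2 : ContMDiffOn 𝓘(ℂ, ℂ × ℂ) 𝓘(ℂ, ℂ × ℂ) ω (bigChart F ξ j c true).symm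
      (bigChart F ξ j c true).target :=
    contMDiffOn_symm_of_mem_maximalAtlas (IsManifold.subset_maximalAtlas ⟨j, c, hc, true, rfl⟩)
  have h3 := h2.comp h1 fun t ht => by
    have := bigChart_secInfty (ξ := ξ) ht.1 ht.2
    rw [mem_preimage, ← this.2]
    exact (bigChart F ξ j c true).map_source this.1
  refine (h3.contMDiffAt (hO.mem_nhds hr)).congr_of_eventuallyEq ?_
  filter_upwards [hO.mem_nhds hr] with t ht
  have := bigChart_secInfty (ξ := ξ) ht.1 ht.2
  rw [Function.comp_apply, ← this.2, (bigChart F ξ j c true).left_inv this.1]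

theorem continuous_proj : Continuous (proj F ξ) := (contMDiff_proj F ξ).continuous

/-- The frames of two systems of local data differ by locally constant factors along `Y`.  The
modulus of the factor is a global function on the compact connected `Y ≅ R`, since the constants
`t j k` have modulus one; it is locally the modulus of a holomorphic function, so it is constant by
the maximum principle. -/
theorem quot_frame_locally_const [CompactSpace R] [ConnectedSpace R]
    {L : HolLineBundle (ℂ × ℂ) (Surface F ξ)} {ι κ : Type u}
    (S : ObstructionSystem ι (Y F ξ) L) (S' : ObstructionSystem κ (Y F ξ) L) (j : ι) (a : κ)
    (y : Surface F ξ) (hy : y ∈ Y F ξ) (hj : y ∈ S.V j) (ha : y ∈ S'.V a) :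
    ∀ᶠ z in 𝓝[Y F ξ] y, L.quot (S'.e a z) (S.e j z) = L.quot (S'.e a y) (S.e j y) := by
  let s := secInfty F ξ
  have hs : Continuous s := (contMDiff_secInfty F ξ).continuous
  have hsY : ∀ r, s r ∈ Y F ξ := secInfty_mem_Y
  choose J hJ using fun r => S.cover ⟨s r, hsY r⟩
  choose A hA using fun r => S'.cover ⟨s r, hsY r⟩
  -- the modulus of the factor, read at each point through one choice of frames
  let N : R → ℝ := fun r => ‖L.quot (S'.e (A r) (s r)) (S.e (J r) (s r))‖
  have hN : ∀ (j : ι) (a : κ) (r : R), s r ∈ S.V j → s r ∈ S'.V a →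
      N r = ‖L.quot (S'.e a (s r)) (S.e j (s r))‖ := by
    intro j a r hj ha
    have n1 := (S'.frame (A r)).2 (s r) (hA r)
    have n2 := (S.frame (J r)).2 (s r) (hJ r)
    rw [← L.quot_mul_quot _ n1 (S.e j (s r)), ← L.quot_mul_quot (S'.e (A r) (s r)) n2,
      S'.quot_frame_eq (hsY r) (hA r) ha, S.quot_frame_eq (hsY r) hj (hJ r), norm_mul, norm_mul,
      Circle.norm_coe, Circle.norm_coe, one_mul, mul_one]
  have hhol : ∀ (j : ι) (a : κ) (r : R), s r ∈ S.V j → s r ∈ S'.V a →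
      ∀ᶠ t in 𝓝 r, (s t ∈ S.V j ∧ s t ∈ S'.V a) ∧ MDifferentiableAt 𝓘(ℂ) 𝓘(ℂ, ℂ)
        (fun t => L.quot (S'.e a (s t)) (S.e j (s t))) t := by
    intro j a r hj ha
    let U : Opens R := ⟨s ⁻¹' (S.V j ⊓ S'.V a : Opens (Surface F ξ)),
      (S.V j ⊓ S'.V a).isOpen.preimage hs⟩
    have hU : IsHol ℂ U (fun t => L.quot (S'.e a (s t)) (S.e j (s t))) :=
      (S.isHol_quot_frame S' j a).comp (contMDiff_secInfty F ξ) fun t ht => ht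
    filter_upwards [U.isOpen.mem_nhds (show r ∈ U from ⟨hj, ha⟩)] with t ht
    exact ⟨ht, hU.mdifferentiableAt ht⟩
  have hNloc : ∀ (j : ι) (a : κ) (r : R), s r ∈ S.V j → s r ∈ S'.V a →
      N =ᶠ[𝓝 r] fun t => ‖L.quot (S'.e a (s t)) (S.e j (s t))‖ := fun j a r hj ha =>
    (hhol j a r hj ha).mono fun t ht => hN j a t ht.1.1 ht.1.2
  have hNc : Continuous N := continuous_iff_continuousAt.2 fun r =>
    ((hhol _ _ r (hJ r) (hA r)).self_of_nhds.2.continuousAt.norm).congr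
      (hNloc _ _ r (hJ r) (hA r)).symm
  obtain ⟨m, -, hm⟩ := isCompact_univ.exists_isMaxOn univ_nonempty hNc.continuousOn
  -- the set where `N` is maximal is open by the maximum principle
  have hclopen : IsClopen {r | N r = N m} := by
    refine ⟨isClosed_eq hNc continuous_const, isOpen_iff_mem_nhds.2 fun r hr => ?_⟩
    have hmax : IsLocalMax (norm ∘ fun t => L.quot (S'.e (A r) (s t)) (S.e (J r) (s t))) r := by
      filter_upwards [hNloc _ _ r (hJ r) (hA r)] with t ht
      change ‖L.quot (S'.e (A r) (s t)) (S.e (J r) (s t))‖ ≤ N r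
      rw [← ht, show N r = N m from hr]
      exact hm (mem_univ t)
    filter_upwards [hNloc _ _ r (hJ r) (hA r),
      Complex.norm_eventually_eq_of_mdifferentiableAt_of_isLocalMax
        ((hhol _ _ r (hJ r) (hA r)).mono fun t ht => ht.2) hmax] with t h1 h2
    exact (h1.trans h2).trans hr
  have hconst : ∀ r, N r = N m := fun r =>
    (eq_univ_iff_forall.1 (hclopen.eq_univ ⟨m, rfl⟩)) r
  have hsy : s (proj F ξ y) = y := secInfty_proj hy
  have hj' : s (proj F ξ y) ∈ S.V j := by rwa [hsy]
  have ha' : s (proj F ξ y) ∈ S'.V a := by rwa [hsy]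
  have hev := eventually_eq_of_norm_eventually_eq
    ((hhol j a _ hj' ha').mono fun t ht => ht.2) (by
      filter_upwards [hNloc j a _ hj' ha'] with t ht
      rw [← ht, ← hN j a _ hj' ha', hconst, hconst (proj F ξ y)])
  filter_upwards [(continuous_proj.continuousAt.eventually hev).filter_mono nhdsWithin_le_nhds,
    self_mem_nhdsWithin] with z hz hzY
  have hsz : s (proj F ξ z) = z := secInfty_proj hzY
  rwa [hsz, hsy] at hz

/-! ### Conormal covectors along the curve at infinity -/

theorem mvfderiv_theta_ne_zero {j : F.ι} {x : Surface F ξ} (hx : x ∈ V F ξ j) :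
    mvfderiv 𝓘(ℂ, ℂ × ℂ) (theta F ξ j) x ≠ 0 := by
  intro h0
  set c := chartAt ℂ (proj F ξ x)
  have hc : c ∈ atlas ℂ R := chart_mem_atlas ℂ _
  set Ψ := bigChart F ξ j c true
  have hxΨ : x ∈ Ψ.source := mem_bigChart_true_source hx
  have hΨx := Ψ.map_source hxΨ
  have hsymm : ContMDiffOn 𝓘(ℂ, ℂ × ℂ) 𝓘(ℂ, ℂ × ℂ) ω Ψ.symm Ψ.target :=
    contMDiffOn_symm_of_mem_maximalAtlas (IsManifold.subset_maximalAtlas ⟨j, c, hc, true, rfl⟩)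
  have hd : MDifferentiableAt 𝓘(ℂ, ℂ × ℂ) 𝓘(ℂ, ℂ × ℂ) Ψ.symm (Ψ x) :=
    (hsymm.contMDiffAt (Ψ.open_target.mem_nhds hΨx)).mdifferentiableAt (by simp)
  have hθ : MDifferentiableAt 𝓘(ℂ, ℂ × ℂ) 𝓘(ℂ, ℂ) (theta F ξ j) x :=
    (hol_theta F ξ j).mdifferentiableAt hx
  have h1 : mvfderiv 𝓘(ℂ, ℂ × ℂ) (theta F ξ j ∘ Ψ.symm) (Ψ x) =
      mvfderiv 𝓘(ℂ, ℂ × ℂ) (fun q : ℂ × ℂ => q.2) (Ψ x) := by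
    apply mvfderiv_congr_of_eventuallyEq
    filter_upwards [Ψ.open_target.mem_nhds hΨx] with q hq
    rw [Function.comp_apply, ← bigChart_true_snd j c, Ψ.right_inv hq]
  have h2 := mvfderiv_comp_apply_of_eq (Ψ x) hθ hd (Ψ.left_inv hxΨ) ((0, 1) : ℂ × ℂ)
  rw [h0] at h2
  have h3 := DFunLike.congr_fun h1 ((0, 1) : ℂ × ℂ)
  exact one_ne_zero ((mvfderiv_snd (Ψ x) (0, 1)).symm.trans (h3.symm.trans h2))

theorem isDefiningFunction_theta (j : F.ι) :
    IsDefiningFunction (ℂ × ℂ) (Y F ξ) (V F ξ j) (theta F ξ j) :=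
  ⟨hol_theta F ξ j, fun _ hx => (theta_eq_zero_iff hx).symm,
    fun _ hx _ => mvfderiv_theta_ne_zero hx⟩

/-- A function vanishing on `Y` has differential `g dθ_j` along `Y`, with `g` holomorphic: in the
coordinates `(c, θ_j)` of `X`, the function `g` is the partial derivative with respect to `θ_j`,
the derivative along `Y` being zero. -/
theorem exists_mvfderiv_eq_smul_theta {O : Opens (Surface F ξ)} {φ : Surface F ξ → ℂ}
    (hφ : IsHol (ℂ × ℂ) O φ) (hφY : ∀ z ∈ O, z ∈ Y F ξ → φ z = 0) {j : F.ι} {y : Surface F ξ}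
    (hy : y ∈ O) (hj : y ∈ V F ξ j) :
    ∃ O' : Opens (Surface F ξ), y ∈ O' ∧ O' ≤ O ⊓ V F ξ j ∧ ∃ g : Surface F ξ → ℂ,
      IsHol (ℂ × ℂ) O' g ∧ ∀ z ∈ O', z ∈ Y F ξ →
        mvfderiv 𝓘(ℂ, ℂ × ℂ) φ z = g z • mvfderiv 𝓘(ℂ, ℂ × ℂ) (theta F ξ j) z := by
  set c := chartAt ℂ (proj F ξ y)
  have hc : c ∈ atlas ℂ R := chart_mem_atlas ℂ _
  set Ψ := bigChart F ξ j c true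
  have hΨV : ∀ z ∈ Ψ.source, z ∈ V F ξ j ∧ proj F ξ z ∈ c.source := by
    intro z hz
    rw [bigChart_source] at hz
    exact ⟨⟨hz.1, hz.2.2⟩, hz.2.1⟩
  have hsymm : ContMDiffOn 𝓘(ℂ, ℂ × ℂ) 𝓘(ℂ, ℂ × ℂ) ω Ψ.symm Ψ.target :=
    contMDiffOn_symm_of_mem_maximalAtlas (IsManifold.subset_maximalAtlas ⟨j, c, hc, true, rfl⟩)
  have hΨ : ContMDiffOn 𝓘(ℂ, ℂ × ℂ) 𝓘(ℂ, ℂ × ℂ) ω Ψ Ψ.source := contMDiffOn_bigChart F ξ j c hc true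
  let D : Set (ℂ × ℂ) := Ψ.target ∩ Ψ.symm ⁻¹' O
  have hD : IsOpen D := Ψ.symm.isOpen_inter_preimage O.isOpen
  let G : ℂ × ℂ → ℂ := φ ∘ Ψ.symm
  have hG : ContDiffOn ℂ ω G D := contMDiffOn_iff_contDiffOn.1
    (ContMDiffOn.comp hφ (hsymm.mono inter_subset_left) fun q hq => hq.2)
  have hG' : ContDiffOn ℂ ω (fun q => fderiv ℂ G q (0, 1)) D :=
    (hG.fderiv_of_isOpen hD le_rfl).clm_apply contDiffOn_const
  let O' : Opens (Surface F ξ) := O ⊓ ⟨Ψ.source, Ψ.open_source⟩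
  have hO'D : ∀ z ∈ O', Ψ z ∈ D := fun z hz =>
    ⟨Ψ.map_source hz.2, by rw [mem_preimage, Ψ.left_inv hz.2]; exact hz.1⟩
  refine ⟨O', ⟨hy, mem_bigChart_true_source hj⟩, fun z hz => ⟨hz.1, (hΨV z hz.2).1⟩,
    fun z => fderiv ℂ G (Ψ z) (0, 1), ?_, fun z hz hzY => ?_⟩
  · exact ContMDiffOn.comp (contMDiffOn_iff_contDiffOn.2 hG') (hΨ.mono fun z hz => hz.2) hO'D
  · have hGd : DifferentiableAt ℂ G (Ψ z) :=
      (hG.contDiffAt (hD.mem_nhds (hO'D z hz))).differentiableAt (by simp)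
    have hΨd : MDifferentiableAt 𝓘(ℂ, ℂ × ℂ) 𝓘(ℂ, ℂ × ℂ) Ψ z :=
      (hΨ.contMDiffAt (Ψ.open_source.mem_nhds hz.2)).mdifferentiableAt (by simp)
    have hΨz : Ψ z = (c (proj F ξ z), 0) := by
      have := bigChart_secInfty (ξ := ξ) (hΨV z hz.2).1.1 (hΨV z hz.2).2
      rw [secInfty_proj hzY] at this
      exact this.2
    -- the derivative of `G` along `Y`
    have hfst : fderiv ℂ G (Ψ z) (1, 0) = 0 := by
      have h1 : HasFDerivAt (fun u : ℂ => ((u, 0) : ℂ × ℂ)) (ContinuousLinearMap.inl ℂ ℂ ℂ)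
          (c (proj F ξ z)) := (ContinuousLinearMap.inl ℂ ℂ ℂ).hasFDerivAt
      have h2 : HasFDerivAt G (fderiv ℂ G (Ψ z)) ((c (proj F ξ z), 0) : ℂ × ℂ) := by
        rw [← hΨz]; exact hGd.hasFDerivAt
      have h3 := HasFDerivAt.comp (c (proj F ξ z)) h2 h1
      have h4 : (G ∘ fun u : ℂ => ((u, 0) : ℂ × ℂ)) =ᶠ[𝓝 (c (proj F ξ z))] fun _ => 0 := by
        have hcont : ContinuousAt (fun u : ℂ => ((u, 0) : ℂ × ℂ)) (c (proj F ξ z)) := by fun_prop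
        have hDz : D ∈ 𝓝 ((c (proj F ξ z), 0) : ℂ × ℂ) := hD.mem_nhds (hΨz ▸ hO'D z hz)
        filter_upwards [hcont hDz] with u hu
        refine hφY _ hu.2 ?_
        have hs : Ψ.symm (u, 0) ∈ Ψ.source := Ψ.map_target hu.1
        rw [← theta_eq_zero_iff (hΨV _ hs).1, ← bigChart_true_snd j c]
        exact congrArg Prod.snd (Ψ.right_inv hu.1)
      have h5 := h3.congr_of_eventuallyEq h4.symm
      have h6 := h5.unique (hasFDerivAt_const (0 : ℂ) (c (proj F ξ z)))
      have h7 := DFunLike.congr_fun h6 1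
      simpa using h7
    have hφG : mvfderiv 𝓘(ℂ, ℂ × ℂ) φ z = mvfderiv 𝓘(ℂ, ℂ × ℂ) (G ∘ Ψ) z := by
      apply mvfderiv_congr_of_eventuallyEq
      filter_upwards [Ψ.open_source.mem_nhds hz.2] with t ht
      exact congrArg φ (Ψ.left_inv ht).symm
    ext v
    have e1 := mvfderiv_comp_apply z hGd.mdifferentiableAt hΨd v
    have e2 : mvfderiv 𝓘(ℂ, ℂ × ℂ) (theta F ξ j) z v = _ :=
      mvfderiv_comp_apply (g := fun q : ℂ × ℂ => q.2) z differentiableAt_snd.mdifferentiableAt hΨd v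
    change _ = fderiv ℂ G (Ψ z) (0, 1) * _
    rw [hφG]
    refine e1.trans ((?_ : _ = fderiv ℂ G (Ψ z) (0, 1) * _).trans
      (congrArg (fun w => fderiv ℂ G (Ψ z) (0, 1) * w) e2).symm)
    generalize (mfderiv 𝓘(ℂ, ℂ × ℂ) 𝓘(ℂ, ℂ × ℂ) Ψ z) v = q
    refine (mvfderiv_eq_fderiv G (Ψ z) q).trans ((?_ : _ = fderiv ℂ G (Ψ z) (0, 1) * _).trans
      (congrArg (fun w => fderiv ℂ G (Ψ z) (0, 1) * w) (mvfderiv_snd (Ψ z) q)).symm)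
    obtain ⟨q₁, q₂⟩ := q
    have e3 : ((q₁, q₂) : ℂ × ℂ) = q₁ • ((1, 0) : ℂ × ℂ) + q₂ • ((0, 1) : ℂ × ℂ) := by simp
    change fderiv ℂ G (Ψ z) ((q₁, q₂) : ℂ × ℂ) = _ * q₂
    rw [e3, map_add, map_smul, map_smul, hfst, smul_zero, zero_add, smul_eq_mul, mul_comm]

end Grauert

/-! ### Frames given by the local trivializations -/

namespace HolLineBundle

variable {E : Type*} [NormedAddCommGroup E] [NormedSpace ℂ E] {X : Type u}
  [TopologicalSpace X] [ChartedSpace E X] (L : HolLineBundle E X)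

theorem g_self_eq_one {i : L.ι} {x : X} (hi : x ∈ L.dom i) : L.g i i x = 1 :=
  mul_left_cancel₀ (L.ne_zero i i x hi hi) (by rw [L.cocycle i i i x hi hi hi, mul_one])

theorem fiber_ext {x : X} {a b : L.fiber x} {i : L.ι} (hi : x ∈ L.dom i) (h : a.1 i = b.1 i) :
    a = b := by
  rw [← sub_eq_zero]
  by_contra hne
  exact L.fiber_apply_ne_zero hne hi (sub_eq_zero.2 h)

theorem frame_apply {i k : L.ι} {x : X} (hi : x ∈ L.dom i) (hk : x ∈ L.dom k) :
    (L.frame i x).1 k = L.g k i x :=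
  if_pos ⟨hi, hk⟩

theorem frame_self_apply {i : L.ι} {x : X} (hi : x ∈ L.dom i) : (L.frame i x).1 i = 1 := by
  rw [L.frame_apply hi hi, L.g_self_eq_one hi]

theorem frame_ne_zero {i : L.ι} {x : X} (hi : x ∈ L.dom i) : L.frame i x ≠ 0 := by
  intro h
  have := L.frame_self_apply hi
  rw [h] at this
  exact zero_ne_one this

theorem isFrame_frame (i : L.ι) : L.IsFrame (L.dom i) (L.frame i) :=
  ⟨fun k => IsHol.congr ((L.hol k i).mono (le_of_eq (inf_comm _ _)))
    fun _ hx => L.frame_apply hx.1 hx.2, fun _ hx => L.frame_ne_zero hx⟩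

theorem frame_eq_smul {j k : L.ι} {x : X} (hj : x ∈ L.dom j) (hk : x ∈ L.dom k) :
    L.frame k x = L.g j k x • L.frame j x := by
  refine L.fiber_ext hj ?_
  change (L.frame k x).1 j = L.g j k x * (L.frame j x).1 j
  rw [L.frame_self_apply hj, mul_one, L.frame_apply hk hj]

theorem eq_smul_frame {i : L.ι} {x : X} (hi : x ∈ L.dom i) (a : L.fiber x) :
    a = a.1 i • L.frame i x := by
  refine L.fiber_ext hi ?_
  change a.1 i = a.1 i * (L.frame i x).1 i
  rw [L.frame_self_apply hi, mul_one]

variable {L} in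
theorem IsHolSection.smul {U : Opens X} {g : X → ℂ} {s : ∀ x, L.fiber x} (hg : IsHol E U g)
    (hs : L.IsHolSection U s) : L.IsHolSection U (fun x => g x • s x) :=
  fun i => (hg.mono inf_le_left).mul (hs i)

theorem smul_tmul_smul {M : HolLineBundle E X} {x : X} (c d : ℂ) (a : L.fiber x) (b : M.fiber x) :
    tmul (c • a) (d • b) = (c * d) • tmul a b := by
  ext i
  exact mul_mul_mul_comm _ _ _ _

variable {L} in
theorem IsFrame.tmul {M : HolLineBundle E X} {U V : Opens X} {e : ∀ x, L.fiber x}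
    {f : ∀ x, M.fiber x} (he : L.IsFrame U e) (hf : M.IsFrame V f) :
    (L.tensor M).IsFrame (U ⊓ V) (fun x => HolLineBundle.tmul (e x) (f x)) := by
  refine ⟨fun i => ((he.1 i.1).mono (inf_le_inf inf_le_left inf_le_left)).mul
    ((hf.1 i.2).mono (inf_le_inf inf_le_right inf_le_right)), fun x hx h => ?_⟩
  obtain ⟨i, hi⟩ := L.cover x
  obtain ⟨k, hk⟩ := M.cover x
  have h1 : (HolLineBundle.tmul (e x) (f x)).1 (i, k) = 0 :=
    congrFun (congrArg Subtype.val h) (i, k)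
  exact mul_ne_zero (L.fiber_apply_ne_zero (he.2 x hx.1) hi)
    (M.fiber_apply_ne_zero (hf.2 x hx.2) hk) h1

end HolLineBundle

namespace Grauert

variable {R : Type u} [TopologicalSpace R] [ChartedSpace ℂ R]
  (F : HolLineBundle ℂ R) (ξ : F.sheaf.Z1 F.dom) [IsManifold 𝓘(ℂ) ω R]

/-! ### The local data given by the construction of the surface -/

variable {F ξ}

theorem isFrame_frameL (j : F.ι) : (bundleL F ξ).IsFrame (V F ξ j) (frameL F ξ j) :=
  (((F.pullback (proj F ξ) (contMDiff_proj F ξ)).isFrame_frame j).tmul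
    ((bundleY F ξ).isFrame_frame (some j))).mono (le_inf (fun _ hx => hx.1) le_rfl)

/-- The quotient `e_k / e_j = a_{jk} / (a_{jk} + ξ_{jk} θ_k)` is exactly `1 - ξ_{jk} θ_j`. -/
theorem frameL_eq_smul {j k : F.ι} {x : Surface F ξ} (hj : x ∈ V F ξ j) (hk : x ∈ V F ξ k) :
    frameL F ξ k x = (1 - coeff F ξ j k (proj F ξ x) * theta F ξ j x) • frameL F ξ j x := by
  have h1 : framePullback F ξ k x = F.g j k (proj F ξ x) • framePullback F ξ j x :=
    (F.pullback (proj F ξ) (contMDiff_proj F ξ)).frame_eq_smul hj.1 hk.1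
  have h2 : (bundleY F ξ).frame (some k) x = _ • (bundleY F ξ).frame (some j) x :=
    (bundleY F ξ).frame_eq_smul (j := some j) (k := some k) hj hk
  have h3 : (bundleY F ξ).g (some j) (some k) x =
    (F.g j k (proj F ξ x) + coeff F ξ j k (proj F ξ x) * theta F ξ k x)⁻¹ := rfl
  obtain ⟨h4, h5⟩ := theta_change hj hk
  rw [frameL, frameL, h1, h2, HolLineBundle.smul_tmul_smul, h3, h5]
  congr 1
  field_simp
  ring

theorem quot_frameL {j k : F.ι} {x : Surface F ξ} (hj : x ∈ V F ξ j) (hk : x ∈ V F ξ k) :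
    (bundleL F ξ).quot (frameL F ξ k x) (frameL F ξ j x) =
      1 - coeff F ξ j k (proj F ξ x) * theta F ξ j x := by
  rw [frameL_eq_smul hj hk, HolLineBundle.quot_smul_left,
    HolLineBundle.quot_self _ ((isFrame_frameL j).2 x hj), mul_one]

theorem quot_frameL_eventuallyEq {j k : F.ι} {y : Surface F ξ} (hj : y ∈ V F ξ j)
    (hk : y ∈ V F ξ k) : ∀ᶠ x in 𝓝 y,
      (bundleL F ξ).quot (frameL F ξ k x) (frameL F ξ j x) =
        1 - coeff F ξ j k (proj F ξ x) * theta F ξ j x := by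
  filter_upwards [(V F ξ j).isOpen.mem_nhds hj, (V F ξ k).isOpen.mem_nhds hk] with x h1 h2
  exact quot_frameL h1 h2

variable (F ξ) in
/-- The local data `θ_j`, `e_j = p^*m_j ⊗ v_j` and `t_{jk} = 1` on the open sets `V j`, with
`f_{jk} = -ξ_{jk} ∘ p`. -/
noncomputable def standardSystem : ObstructionSystem F.ι (Y F ξ) (bundleL F ξ) where
  V := V F ξ
  cover y := by
    obtain ⟨j, hj⟩ := F.cover (proj F ξ y.1)
    exact ⟨j, mem_V_of_mem_Y y.2 hj⟩
  θ := theta F ξ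
  defining := isDefiningFunction_theta
  e := frameL F ξ
  frame := isFrame_frameL
  t _ _ := 1
  flat j k y hy hj hk := by
    rw [Circle.coe_one, inv_one, one_smul, frameL_eq_smul hj hk, (theta_eq_zero_iff hj).2 hy,
      mul_zero, sub_zero, one_smul]
  f j k x := -coeff F ξ j k (proj F ξ x)
  hol j k := by
    have h : IsHol (ℂ × ℂ) (V F ξ j ⊓ V F ξ k) (fun x => coeff F ξ j k (proj F ξ x)) :=
      (coeff_hol F ξ j k).comp (contMDiff_proj F ξ) fun x hx => ⟨hx.1.1, hx.2.1⟩
    exact h.neg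
  expansion j k y hy hj hk := by
    refine Asymptotics.IsBigO.congr' (Asymptotics.isBigO_zero (E' := ℂ) _ _) ?_ EventuallyEq.rfl
    filter_upwards [quot_frameL_eventuallyEq hj hk] with x hx
    rw [Circle.coe_one, inv_one, one_smul, hx]
    ring

/-- All systems of local data define the first obstruction class. -/
theorem cohClass_eq_firstObstructionClass [CompactSpace R] [ConnectedSpace R] {κ : Type u}
    (S : ObstructionSystem κ (Y F ξ) (bundleL F ξ)) :
    S.cohClass S.cochain_mem_Z1 = firstObstructionClass (Y F ξ) (bundleL F ξ) :=
  (firstObstructionClass_eq S fun _ S' =>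
    S.cohClass_eq S' fun j a y hy hj ha => quot_frame_locally_const S S' j a y hy hj ha).symm

/-! ### The isomorphism of the conormal bundle of `Y` with the pullback of `F` -/

/-- The covector `dθ_j` at a point of `Y ∩ V j`, as an element of the conormal space. -/
noncomputable def dtheta (j : F.ι) (y : Y F ξ) (hj : proj F ξ y.1 ∈ F.dom j) :
    conormalSpace (ℂ × ℂ) (Y F ξ) y.1 :=
  ⟨mvfderiv 𝓘(ℂ, ℂ × ℂ) (theta F ξ j) y.1, V F ξ j, mem_V_of_mem_Y y.2 hj, theta F ξ j,
    hol_theta F ξ j, fun _ hz => (theta_eq_zero_iff hz).2, rfl⟩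

/-- `dθ_j = a_{jk}⁻¹ dθ_k` along `Y`, the inverse of the transition rule of the frames `m_j`. -/
theorem dtheta_eq_smul {j k : F.ι} {y : Y F ξ} (hj : proj F ξ y.1 ∈ F.dom j)
    (hk : proj F ξ y.1 ∈ F.dom k) :
    dtheta j y hj = (F.g j k (proj F ξ y.1))⁻¹ • dtheta k y hk := by
  apply Subtype.ext
  have hjV := mem_V_of_mem_Y y.2 hj
  have hkV := mem_V_of_mem_Y y.2 hk
  have h0 := (theta_eq_zero_iff hkV).2 y.2
  have h1 : mvfderiv 𝓘(ℂ, ℂ × ℂ) (theta F ξ j) y.1 = mvfderiv 𝓘(ℂ, ℂ × ℂ)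
      (fun x => (bundleY F ξ).g (some j) (some k) x * theta F ξ k x) y.1 := by
    apply mvfderiv_congr_of_eventuallyEq
    filter_upwards [(V F ξ j).isOpen.mem_nhds hjV, (V F ξ k).isOpen.mem_nhds hkV] with x hx hx'
    rw [(theta_change hx hx').2, div_eq_inv_mul]
    rfl
  change mvfderiv 𝓘(ℂ, ℂ × ℂ) (theta F ξ j) y.1 =
    (F.g j k (proj F ξ y.1))⁻¹ • mvfderiv 𝓘(ℂ, ℂ × ℂ) (theta F ξ k) y.1
  rw [h1, mvfderiv_mul_of_right_eq_zero
    (((bundleY F ξ).hol (some j) (some k)).mdifferentiableAt ⟨hjV, hkV⟩)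
    ((hol_theta F ξ k).mdifferentiableAt hkV) h0]
  congr 1
  change (F.g j k (proj F ξ y.1) + coeff F ξ j k (proj F ξ y.1) * theta F ξ k y.1)⁻¹ = _
  rw [h0, mul_zero, add_zero]

theorem bijective_smul_dtheta {j : F.ι} {y : Y F ξ} (hj : proj F ξ y.1 ∈ F.dom j) :
    Function.Bijective (LinearMap.toSpanSingleton ℂ _ (dtheta j y hj)) := by
  refine ⟨(injective_iff_map_eq_zero _).2 fun c hc => ?_, ?_⟩
  · refine (smul_eq_zero.1 hc).resolve_right fun h => ?_
    exact mvfderiv_theta_ne_zero (mem_V_of_mem_Y y.2 hj) (congrArg Subtype.val h)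
  · rintro ⟨_, O, hO, φ, hφ, hφY, rfl⟩
    obtain ⟨O', hyO', -, g, -, hg⟩ :=
      exists_mvfderiv_eq_smul_theta hφ hφY hO (mem_V_of_mem_Y y.2 hj)
    exact ⟨g y.1, Subtype.ext (hg _ hyO' y.2).symm⟩

theorem bijective_smul_framePullback {j : F.ι} {x : Surface F ξ} (hj : proj F ξ x ∈ F.dom j) :
    Function.Bijective (LinearMap.toSpanSingleton ℂ _ (framePullback F ξ j x)) :=
  ⟨(injective_iff_map_eq_zero _).2 fun _ hc => (smul_eq_zero.1 hc).resolve_right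
      ((F.pullback (proj F ξ) (contMDiff_proj F ξ)).frame_ne_zero hj),
    fun a => ⟨_, ((F.pullback (proj F ξ) (contMDiff_proj F ξ)).eq_smul_frame hj a).symm⟩⟩

/-- The isomorphism `N_{Y/X}⁻¹ ≅ (p|_Y)^*F`, defined on the fibre at `y` by `dθ_j ↦ p^*m_j` for a
chosen index `j`; the choice is immaterial by `conormalEquiv_dtheta`. -/
noncomputable def conormalEquiv (y : Y F ξ) : conormalSpace (ℂ × ℂ) (Y F ξ) y.1 ≃ₗ[ℂ]
    (F.pullback (proj F ξ) (contMDiff_proj F ξ)).fiber y.1 :=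
  (LinearEquiv.ofBijective _
      (bijective_smul_dtheta (y := y) (F.cover (proj F ξ y.1)).choose_spec)).symm.trans
    (LinearEquiv.ofBijective _
      (bijective_smul_framePullback (F.cover (proj F ξ y.1)).choose_spec))

theorem conormalEquiv_dtheta {j : F.ι} {y : Y F ξ} (hj : proj F ξ y.1 ∈ F.dom j) :
    conormalEquiv y (dtheta j y hj) = framePullback F ξ j y.1 := by
  have hk := (F.cover (proj F ξ y.1)).choose_spec
  set k := (F.cover (proj F ξ y.1)).choose
  have h1 : conormalEquiv y (dtheta k y hk) = framePullback F ξ k y.1 := by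
    rw [conormalEquiv, LinearEquiv.trans_apply]
    have e1 : dtheta k y hk =
        LinearEquiv.ofBijective _ (bijective_smul_dtheta (y := y) hk) (1 : ℂ) :=
      (one_smul ℂ _).symm
    rw [(LinearEquiv.symm_apply_eq _).2 e1]
    exact one_smul ℂ _
  have h2 : framePullback F ξ j y.1 = F.g k j (proj F ξ y.1) • framePullback F ξ k y.1 :=
    (F.pullback (proj F ξ) (contMDiff_proj F ξ)).frame_eq_smul hk hj
  have h3 : F.g k j (proj F ξ y.1) * F.g j k (proj F ξ y.1) = 1 := by
    rw [F.cocycle k j k _ hk hj hk, F.g_self_eq_one hk]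
  rw [dtheta_eq_smul hj hk, map_smul, h1, h2, eq_inv_of_mul_eq_one_left h3]

theorem conormalEquiv_eq_smul {j : F.ι} {y : Y F ξ} (hj : proj F ξ y.1 ∈ F.dom j) {c : ℂ}
    {α : conormalSpace (ℂ × ℂ) (Y F ξ) y.1}
    (h : α.1 = c • mvfderiv 𝓘(ℂ, ℂ × ℂ) (theta F ξ j) y.1) :
    conormalEquiv y α = c • framePullback F ξ j y.1 := by
  rw [show α = c • dtheta j y hj from Subtype.ext h, map_smul, conormalEquiv_dtheta]

theorem mem_conormalSheaf_sec_iff (W : Opens (Y F ξ))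
    (s : ∀ y : Y F ξ, conormalSpace (ℂ × ℂ) (Y F ξ) y.1) :
    s ∈ (conormalSheaf (ℂ × ℂ) (Y F ξ)).sec W ↔ (fun y => conormalEquiv y (s y)) ∈
      ((F.pullback (proj F ξ) (contMDiff_proj F ξ)).restrictSheaf (Y F ξ)).sec W := by
  constructor
  · intro hs y hy
    obtain ⟨O, hO, φ, hφ, hφY, hsφ⟩ := hs y hy
    obtain ⟨j, hj⟩ := F.cover (proj F ξ y.1)
    obtain ⟨O', hyO', hO', g, hg, hg'⟩ :=
      exists_mvfderiv_eq_smul_theta hφ hφY hO (mem_V_of_mem_Y y.2 hj)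
    refine ⟨O', hyO', fun x => g x • framePullback F ξ j x, HolLineBundle.IsHolSection.smul hg
      (((F.pullback (proj F ξ) (contMDiff_proj F ξ)).isFrame_frame j).mono
        fun x hx => (hO' hx).2.1).1, fun z hz hzO => ?_⟩
    exact conormalEquiv_eq_smul (hO' hzO).2.1
      ((hsφ z hz (hO' hzO).1).trans (hg' z.1 hzO z.2))
  · intro hs y hy
    obtain ⟨O, hO, σ, hσ, hsσ⟩ := hs y hy
    obtain ⟨j, hj⟩ := F.cover (proj F ξ y.1)
    let g : Surface F ξ → ℂ := fun x => (σ x).1 j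
    have hg : IsHol (ℂ × ℂ) (O ⊓ V F ξ j) g := (hσ j).mono (inf_le_inf_left _ fun x hx => hx.1)
    have hθ := (hol_theta F ξ j).mono (inf_le_right (a := O))
    refine ⟨O ⊓ V F ξ j, ⟨hO, mem_V_of_mem_Y y.2 hj⟩, fun x => g x * theta F ξ j x, hg.mul hθ,
      fun z hz hzY => ?_, fun z hz hzO => ?_⟩
    · change g z * theta F ξ j z = 0
      rw [(theta_eq_zero_iff hz.2).2 hzY, mul_zero]
    · have hzj := hzO.2.1
      have h1 : s z = g z.1 • dtheta j z hzj := by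
        apply (conormalEquiv z).injective
        rw [map_smul, conormalEquiv_dtheta]
        exact (hsσ z hz hzO.1).trans
          ((F.pullback (proj F ξ) (contMDiff_proj F ξ)).eq_smul_frame hzj (σ z.1))
      rw [h1, mvfderiv_mul_of_right_eq_zero (hg.mdifferentiableAt hzO) (hθ.mdifferentiableAt hzO)
        ((theta_eq_zero_iff hzO.2).2 z.2)]
      rfl

/-! ### Comparison of the obstruction cocycle with `ξ` -/

/-- Under `N_{Y/X}⁻¹ ≅ (p|_Y)^*F`, the obstruction cocycle is the pullback of `-ξ`. -/
theorem conormalEquiv_cochain {j k : F.ι} {y : Y F ξ} (hj : proj F ξ y.1 ∈ F.dom j)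
    (hk : proj F ξ y.1 ∈ F.dom k) :
    conormalEquiv y ((standardSystem F ξ).cochain j k y) =
      -(show (F.pullback (proj F ξ) (contMDiff_proj F ξ)).fiber y.1 from
        ξ.1 j k (proj F ξ y.1)) := by
  rw [conormalEquiv_eq_smul hj ((standardSystem F ξ).cochain_val_eq_smul
    (mem_V_of_mem_Y y.2 hj) (mem_V_of_mem_Y y.2 hk))]
  refine (neg_smul (coeff F ξ j k (proj F ξ y.1)) (framePullback F ξ j y.1)).trans
    (congrArg Neg.neg ?_)
  exact ((F.pullback (proj F ξ) (contMDiff_proj F ξ)).eq_smul_frame (x := y.1) hj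
    (ξ.1 j k (proj F ξ y.1))).symm

theorem cechClass_standardSystem_eq_zero_iff :
    (standardSystem F ξ).cechClass (standardSystem F ξ).cochain_mem_Z1 = 0 ↔
      F.sheaf.cechClass F.dom ξ = 0 := by
  rw [ObstructionSystem.cechClass, SectionSheaf.cechClass_eq_zero_iff,
    SectionSheaf.cechClass_eq_zero_iff]
  constructor
  · rintro ⟨β, hβ, hβ'⟩
    let s : R → Y F ξ := fun r => ⟨secInfty F ξ r, secInfty_mem_Y r⟩
    -- the fibre of `p^*F` at `s r` is the fibre of `F` at `r`, as `p (s r) = r` holds by definition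
    let b : F.ι → ∀ r, F.fiber r :=
      fun j r => -(show F.fiber r from conormalEquiv (s r) (β j (s r)))
    refine ⟨b, fun j i => IsHol.of_local fun r hr => ?_, fun j k r hj hk => ?_⟩
    · obtain ⟨O, hO, σ, hσ, hβσ⟩ := (mem_conormalSheaf_sec_iff _ _).1 (hβ j) (s r)
        (secInfty_mem_V hr.1)
      have hs := contMDiff_secInfty F ξ
      let O' : Opens R := ⟨secInfty F ξ ⁻¹' O, O.isOpen.preimage hs.continuous⟩
      refine ⟨O' ⊓ (F.dom j ⊓ F.dom i), ⟨hO, hr⟩, IsHol.congr (IsHol.neg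
        ((hσ i).comp hs fun t ht => ⟨ht.1, ht.2.2⟩)) fun t ht => ?_⟩
      exact congrArg (fun a => -a)
        (congrFun (congrArg Subtype.val (hβσ (s t) (secInfty_mem_V ht.2.1) ht.1)) i)
    · have h1 := congrArg (conormalEquiv (s r)) (hβ' j k (s r) (secInfty_mem_V hj)
        (secInfty_mem_V hk))
      rw [map_sub] at h1
      have h2 := (conormalEquiv_cochain (y := s r) hj hk).symm.trans h1
      have h3 : -(ξ.1 j k r) = -(b k r) - -(b j r) := by
        rw [neg_neg, neg_neg]
        exact h2
      rw [← neg_inj, h3]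
      abel
  · rintro ⟨b, hb, hb'⟩
    let c : F.ι → ∀ y : Y F ξ, (F.pullback (proj F ξ) (contMDiff_proj F ξ)).fiber y.1 :=
      fun j y => -(show (F.pullback (proj F ξ) (contMDiff_proj F ξ)).fiber y.1 from
        b j (proj F ξ y.1))
    refine ⟨fun j y => (conormalEquiv y).symm (c j y), fun j => ?_, fun j k y hj hk => ?_⟩
    · rw [mem_conormalSheaf_sec_iff]
      simp only [LinearEquiv.apply_symm_apply]
      intro y hy
      refine ⟨⟨proj F ξ ⁻¹' F.dom j, (F.dom j).isOpen.preimage continuous_proj⟩, hy.1,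
        fun x => -(show (F.pullback (proj F ξ) (contMDiff_proj F ξ)).fiber x from
          b j (proj F ξ x)), fun i => ?_, fun z _ _ => rfl⟩
      exact ((hb j i).comp (contMDiff_proj F ξ) fun x hx => hx).neg
    · have hj' : proj F ξ y.1 ∈ F.dom j := hj.1
      have hk' : proj F ξ y.1 ∈ F.dom k := hk.1
      apply (conormalEquiv y).injective
      rw [map_sub, LinearEquiv.apply_symm_apply, LinearEquiv.apply_symm_apply]
      refine (conormalEquiv_cochain hj' hk').trans ?_
      have h1 := congrArg (fun a => -a) (hb' j k (proj F ξ y.1) hj' hk')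
      have h2 : -(b k (proj F ξ y.1) - b j (proj F ξ y.1)) =
        -b k (proj F ξ y.1) - -b j (proj F ξ y.1) := by abel
      exact h1.trans h2

theorem firstObstructionClass_eq_zero_iff [CompactSpace R] [ConnectedSpace R] :
    firstObstructionClass (Y F ξ) (bundleL F ξ) = 0 ↔ F.sheaf.cechClass F.dom ξ = 0 := by
  rw [← cohClass_eq_firstObstructionClass (standardSystem F ξ),
    ← cechClass_standardSystem_eq_zero_iff]
  exact SectionSheaf.toH1_cechClass_eq_zero_iff _ _ _

end Grauert

theorem claim3p4 {R : Type u} [TopologicalSpace R] [ChartedSpace ℂ R] [IsManifold 𝓘(ℂ) ω R]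
    [CompactSpace R] [T2Space R] [ConnectedSpace R]
    (F : HolLineBundle ℂ R) (ξ : F.sheaf.Z1 F.dom) :
    -- the class `u₁(Y, X, L)` is nonzero if `[ξ]` is, and conversely
    (F.sheaf.cechClass F.dom ξ ≠ 0 →
      firstObstructionClass (Grauert.Y F ξ) (Grauert.bundleL F ξ) ≠ 0) ∧
    (F.sheaf.cechClass F.dom ξ = 0 →
      firstObstructionClass (Grauert.Y F ξ) (Grauert.bundleL F ξ) = 0) ∧
    -- any local data compute the class `u₁(Y, X, L)`
    (∀ (ι : Type u) (S : ObstructionSystem ι (Grauert.Y F ξ) (Grauert.bundleL F ξ)),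
      ∃ hS : S.cochain ∈ (conormalSheaf (ℂ × ℂ) (Grauert.Y F ξ)).Z1 S.W,
        S.cohClass hS = firstObstructionClass (Grauert.Y F ξ) (Grauert.bundleL F ξ)) ∧
    -- the data `θ_j`, `e_j = p^*m_j ⊗ v_j`, `t_{jk} = 1` give the cocycle `-ξ_{jk} dθ_j`
    (∀ j k : F.ι, ∀ y ∈ Grauert.Y F ξ, y ∈ Grauert.V F ξ j → y ∈ Grauert.V F ξ k →
      (fun x => (Grauert.bundleL F ξ).quot (Grauert.frameL F ξ k x) (Grauert.frameL F ξ j x) -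
        (1 - Grauert.coeff F ξ j k (Grauert.proj F ξ x) * Grauert.theta F ξ j x))
        =o[𝓝 y] Grauert.theta F ξ j) ∧
    (∃ S : ObstructionSystem F.ι (Grauert.Y F ξ) (Grauert.bundleL F ξ),
      S.V = Grauert.V F ξ ∧ S.θ = Grauert.theta F ξ ∧ S.e = Grauert.frameL F ξ ∧
      S.t = (fun _ _ => 1) ∧
      S.f = (fun j k x => -Grauert.coeff F ξ j k (Grauert.proj F ξ x)) ∧
      ∃ hS : S.cochain ∈ (conormalSheaf (ℂ × ℂ) (Grauert.Y F ξ)).Z1 S.W,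
        (∀ j k : F.ι, ∀ y : Grauert.Y F ξ, y ∈ S.W j → y ∈ S.W k →
          (S.cochain j k y : TangentSpace 𝓘(ℂ, ℂ × ℂ) y.1 →L[ℂ] ℂ) =
            (-Grauert.coeff F ξ j k (Grauert.proj F ξ y.1)) •
              mvfderiv 𝓘(ℂ, ℂ × ℂ) (Grauert.theta F ξ j) y.1) ∧
        S.cohClass hS = firstObstructionClass (Grauert.Y F ξ) (Grauert.bundleL F ξ) ∧
        (S.cechClass hS = 0 ↔ F.sheaf.cechClass F.dom ξ = 0)) ∧
    -- the isomorphism `N_{Y/X}⁻¹ ≅ (p|_Y)^*F`, `dθ_j ↦ p^*m_j`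
    (∃ Φ : ∀ y : Grauert.Y F ξ, conormalSpace (ℂ × ℂ) (Grauert.Y F ξ) y.1 ≃ₗ[ℂ]
        (F.pullback (Grauert.proj F ξ) (Grauert.contMDiff_proj F ξ)).fiber y.1,
      (∀ (j : F.ι) (y : Grauert.Y F ξ) (α : conormalSpace (ℂ × ℂ) (Grauert.Y F ξ) y.1),
        Grauert.proj F ξ y.1 ∈ F.dom j →
        (α : TangentSpace 𝓘(ℂ, ℂ × ℂ) y.1 →L[ℂ] ℂ) =
          mvfderiv 𝓘(ℂ, ℂ × ℂ) (Grauert.theta F ξ j) y.1 →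
        Φ y α = Grauert.framePullback F ξ j y.1) ∧
      ∀ (W : Opens (Grauert.Y F ξ))
        (s : ∀ y : Grauert.Y F ξ, conormalSpace (ℂ × ℂ) (Grauert.Y F ξ) y.1),
        s ∈ (conormalSheaf (ℂ × ℂ) (Grauert.Y F ξ)).sec W ↔
          (fun y => Φ y (s y)) ∈ ((F.pullback (Grauert.proj F ξ)
            (Grauert.contMDiff_proj F ξ)).restrictSheaf (Grauert.Y F ξ)).sec W) := by
  refine ⟨fun h => mt Grauert.firstObstructionClass_eq_zero_iff.1 h,
    Grauert.firstObstructionClass_eq_zero_iff.2,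
    fun ι S => ⟨S.cochain_mem_Z1, Grauert.cohClass_eq_firstObstructionClass S⟩,
    fun j k y _ hj hk => ?_,
    ⟨Grauert.standardSystem F ξ, rfl, rfl, rfl, rfl, rfl,
      (Grauert.standardSystem F ξ).cochain_mem_Z1,
      fun j k y hj hk => (Grauert.standardSystem F ξ).cochain_val_eq_smul hj hk,
      Grauert.cohClass_eq_firstObstructionClass _, Grauert.cechClass_standardSystem_eq_zero_iff⟩,
    Grauert.conormalEquiv, fun j y α hj h => ?_, Grauert.mem_conormalSheaf_sec_iff⟩
  · refine Asymptotics.IsLittleO.congr' (Asymptotics.isLittleO_zero (E' := ℂ) _ _) ?_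
      EventuallyEq.rfl
    filter_upwards [Grauert.quot_frameL_eventuallyEq hj hk] with x hx
    rw [hx, sub_self]
  · rw [Grauert.conormalEquiv_eq_smul hj (c := 1) (by rw [h, one_smul]), one_smul]
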